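/- **Setting.** Let $d\in\{2,3\}$ and let $\Omega\subset\mathbb{R}^d$ be a bounded simply connected Lipschitz domain. Let $E,t>0$, $\nu\in(-1,1/2]$, $D=\frac{Et^3}{12(1-\nu^2)}$, and let $\mathcal{C}\kappa=D\,[\nu\,\mathrm{tr}(\kappa)I+(1-\nu)\kappa]$ on symmetric $d\times d$ tensors; assume that $\mathcal{C}$ is positive definite (this is automatic for $d=2$ and means $\nu>-1/2$ for $d=3$). $L_2(\Omega)$ and $\mathbb{L}_2^s(\Omega)$ are the square-integrable scalar, respectively symmetric tensor, functions, $(\cdot,\cdot)$ and $\|\cdot\|$ their inner products and norms, and $(\cdot,\cdot)_T$ the inner products over $T\subset\Omega$. A mesh $\mathcal{T}$ of $\Omega$ is a finite set of pairwise disjoint open Lipschitz sets $T\subset\Omega$ that cover $\Omega$ up to a null set; $\mathcal{S}$ denotes its skeleton. Let $\varepsilon\nabla z$ be the (weak) Hessian of $z$ and $\mathrm{div}\,\mathbf{div}\,\Theta$ the (weak) twice iterated divergence of a symmetric tensor $\Theta$; a subscript $\mathcal{T}$ means that they are taken element by element. Put - $H^2(\mathcal{T})=\{z\in L_2(\Omega):\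 \varepsilon_{\mathcal T}\nabla_{\mathcal T}z\in\mathbb{L}_2^s(\Omega)\}$ with $\|z\|_{2,\mathcal{T}}^2=\|z\|^2+\|\varepsilon_{\mathcal T}\nabla_{\mathcal T}z\|^2$, - $H(\mathrm{div}\,\mathbf{div},\mathcal{T})=\{\Theta\in\mathbb{L}_2^s(\Omega):\ \mathrm{div}_{\mathcal T}\mathbf{div}_{\mathcal T}\Theta\in L_2(\Omega)\}$ with $\|\Theta\|_{\mathrm{div}\,\mathbf{div},\mathcal{T}}^2=\|\Theta\|^2+\|\mathrm{div}_{\mathcal T}\mathbf{div}_{\mathcal T}\Theta\|^2$, - $H(\mathrm{div}\,\mathbf{div},\Omega)=\{\Theta\in\mathbb{L}_2^s(\Omega):\ \mathrm{div}\,\mathbf{div}\,\Theta\in L_2(\Omega)\}$, and $H^2_0(\Omega)$ is the closure of $C_c^\infty(\Omega)$ in the norm $(\|z\|^2+\|\varepsilon\nabla z\|^2)^{1/2}$, - $\mathcal{V}=H^2(\mathcal{T})\times H(\mathrm{div}\,\mathbf{div},\mathcal{T})$ with $\|(z,\Theta)\|_{\mathcal V}^2=\|z\|_{2,\mathcal T}^2+\|\Theta\|_{\mathrm{div}\,\mathbf{div},\mathcal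 T}^2$. The trace operators $\mathrm{tr}^{dD}:H(\mathrm{div}\,\mathbf{div},\Omega)\to H^2(\mathcal{T})'$ and $\mathrm{tr}^{Gg}:H^2_0(\Omega)\to H(\mathrm{div}\,\mathbf{div},\mathcal{T})'$ are defined by $$\langle\mathrm{tr}^{dD}(\Theta),z\rangle_{\mathcal S}=\sum_{T\in\mathcal T}\big[(\mathrm{div}\,\mathbf{div}\,\Theta,z)_T-(\Theta,\varepsilon\nabla z)_T\big],\qquad \langle\mathrm{tr}^{Gg}(z),\Theta\rangle_{\mathcal S}=\sum_{T\in\mathcal T}\big[(\mathrm{div}\,\mathbf{div}\,\Theta,z)_T-(\Theta,\varepsilon\nabla z)_T\big].$$ Their ranges are $\mathbf{H}^{-3/2,-1/2}(\mathcal{S})=\mathrm{tr}^{dD}(H(\mathrm{div}\,\mathbf{div},\Omega))$ and $\mathbf{H}^{3/2,1/2}_{00}(\mathcal{S})=\mathrm{tr}^{Gg}(H^2_0(\Omega))$, with the dual norms $$\|q\|_{-3/2,-1/2,\mathcal S}=\sup_{0\ne z\in H^2(\mathcal T)}\frac{\langle q,z\rangle_{\mathcal S}}{\|z\|_{2,\mathcal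 T}},\qquad \|v\|_{3/2,1/2,00,\mathcal S}=\sup_{0\ne\Theta\in H(\mathrm{div}\,\mathbf{div},\mathcal T)}\frac{\langle v,\Theta\rangle_{\mathcal S}}{\|\Theta\|_{\mathrm{div}\,\mathbf{div},\mathcal T}}.$$ Let $\mathcal{U}=L_2(\Omega)\times\mathbb{L}_2^s(\Omega)\times\mathbf{H}^{3/2,1/2}_{00}(\mathcal{S})\times\mathbf{H}^{-3/2,-1/2}(\mathcal{S})$ and $$b(u,M,\hat u,\hat q;z,\Theta)=(M,\varepsilon_{\mathcal T}\nabla_{\mathcal T}z+\mathcal{C}^{-1}\Theta)+(u,\mathrm{div}_{\mathcal T}\mathbf{div}_{\mathcal T}\Theta)+\langle\hat q,z\rangle_{\mathcal S}-\langle\hat u,\Theta\rangle_{\mathcal S}.$$ The ultraweak formulation with right-hand side $L\in\mathcal{V}'$ is: find $(u,M,\hat u,\hat q)\in\mathcal{U}$ such that $b(u,M,\hat u,\hat q;z,\Theta)=L(z,\Theta)$ for all $(z,\Theta)\in\mathcal{V}$; a load $f\in L_2(\Omega)$ corresponds to $L(z,\Theta)=-(f,z)$. **Theorem.** There is a constant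 $c>0$, depending only on $\Omega$ and $\mathcal{C}$, such that for every mesh $\mathcal{T}$ of $\Omega$ the following holds. For every $f\in L_2(\Omega)$, the ultraweak formulation with $L(z,\Theta)=-(f,z)$ has a unique solution $(u,M,\hat u,\hat q)\in\mathcal{U}$, and $$\|u\|+\|M\|+\|\hat u\|_{3/2,1/2,00,\mathcal S}+\|\hat q\|_{-3/2,-1/2,\mathcal S}\le c\,\|f\|.$$ For every $L\in\mathcal{V}'$, the ultraweak formulation with right-hand side $L$ has a unique solution in $\mathcal{U}$, and the same norm of it is bounded by $c\,\|L\|_{\mathcal V'}$. -/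

import Mathlib

open MeasureTheory Set
open scoped ContDiff ENNReal

noncomputable section

namespace Plate

/-! ### Points, symmetric tensors, the elasticity tensor -/

/-- The space `ℝᵈ` with its Euclidean norm. -/
abbrev Pt (d : ℕ) := EuclideanSpace ℝ (Fin d)

/-- The symmetric `d × d` matrices, inside all matrices with the Frobenius inner product
`A : B = ∑ i j, A i j * B i j`. -/
def symSubmodule (d : ℕ) : Submodule ℝ (EuclideanSpace ℝ (Fin d × Fin d)) where
  carrier := {A | ∀ i j, A (i, j) = A (j, i)}
  add_mem' := by
    intro A B hA hB i j
    simp [hA i j, hB i j]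
  zero_mem' := by
    intro i j
    simp
  smul_mem' := by
    intro c A hA i j
    simp [hA i j]

/-- Symmetric tensors, with the Frobenius inner product. -/
def SymTens (d : ℕ) : Type := symSubmodule d

instance (d : ℕ) : NormedAddCommGroup (SymTens d) :=
  inferInstanceAs (NormedAddCommGroup (symSubmodule d))

instance (d : ℕ) : InnerProductSpace ℝ (SymTens d) :=
  inferInstanceAs (InnerProductSpace ℝ (symSubmodule d))

instance (d : ℕ) : FiniteDimensional ℝ (SymTens d) :=
  inferInstanceAs (FiniteDimensional ℝ (symSubmodule d))

/-- The entry `κ i j` of a symmetric tensor. -/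
def entry {d : ℕ} (κ : SymTens d) (i j : Fin d) : ℝ :=
  (κ : symSubmodule d).1 (i, j)

theorem entry_symm {d : ℕ} (κ : SymTens d) (i j : Fin d) : entry κ i j = entry κ j i :=
  (κ : symSubmodule d).2 i j

theorem SymTens.ext {d : ℕ} {κ τ : SymTens d} (h : ∀ i j, entry κ i j = entry τ i j) : κ = τ :=
  Subtype.ext (PiLp.ext fun p => h p.1 p.2)

@[simp] theorem entry_zero {d : ℕ} (i j : Fin d) : entry (0 : SymTens d) i j = 0 := rfl

@[simp] theorem entry_add {d : ℕ} (κ τ : SymTens d) (i j : Fin d) :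
    entry (κ + τ) i j = entry κ i j + entry τ i j := rfl

@[simp] theorem entry_smul {d : ℕ} (c : ℝ) (κ : SymTens d) (i j : Fin d) :
    entry (c • κ) i j = c * entry κ i j := rfl

theorem inner_symTens {d : ℕ} (κ τ : SymTens d) :
    inner ℝ κ τ = ∑ i, ∑ j, entry κ i j * entry τ i j := by
  have h : inner ℝ κ τ = inner ℝ (κ : symSubmodule d).1 (τ : symSubmodule d).1 := rfl
  rw [h, PiLp.inner_apply, Fintype.sum_prod_type]
  exact Finset.sum_congr rfl fun i _ => Finset.sum_congr rfl fun j _ => mul_comm _ _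

/-- The identity tensor. -/
def idTens (d : ℕ) : SymTens d :=
  ⟨WithLp.toLp 2 (fun p : Fin d × Fin d => if p.1 = p.2 then (1 : ℝ) else 0), by
    intro i j
    simp [eq_comm]⟩

/-- The trace of a symmetric tensor. -/
def traceTens (d : ℕ) : SymTens d →ₗ[ℝ] ℝ where
  toFun κ := ∑ i, entry κ i i
  map_add' κ τ := by simp [Finset.sum_add_distrib]
  map_smul' c κ := by simp [Finset.mul_sum]

/-- The bending rigidity `D = E t³ / (12 (1 - ν²))`. -/
def rigidity (E t ν : ℝ) : ℝ := E * t ^ 3 / (12 * (1 - ν ^ 2))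

/-- The elasticity tensor `𝒞 κ = D (ν tr(κ) I + (1 - ν) κ)`. -/
def stiffness (d : ℕ) (D ν : ℝ) : SymTens d →ₗ[ℝ] SymTens d :=
  D • (ν • (traceTens d).smulRight (idTens d) + (1 - ν) • LinearMap.id)

/-- The inverse of the elasticity tensor, in closed form:
`𝒞⁻¹ τ = (τ - ν / (1 + (d - 1) ν) tr(τ) I) / (D (1 - ν))`;
see `stiffness_compliance` and `compliance_stiffness`. -/
def compliance (d : ℕ) (D ν : ℝ) : SymTens d →ₗ[ℝ] SymTens d :=
  (D * (1 - ν))⁻¹ •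
    (LinearMap.id - (ν / (1 + ((d : ℝ) - 1) * ν)) • (traceTens d).smulRight (idTens d))

theorem traceTens_idTens (d : ℕ) : traceTens d (idTens d) = d := by
  simp [traceTens, entry, idTens]

theorem stiffness_compliance {d : ℕ} {D ν : ℝ} (hD : D ≠ 0) (hν : 1 - ν ≠ 0)
    (hd : 1 + ((d : ℝ) - 1) * ν ≠ 0) (τ : SymTens d) :
    stiffness d D ν (compliance d D ν τ) = τ := by
  simp only [stiffness, compliance, LinearMap.smul_apply, LinearMap.add_apply,
    LinearMap.sub_apply, LinearMap.smulRight_apply, LinearMap.id_apply, map_smul, map_sub,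
    traceTens_idTens]
  have hd' : 1 + ν * ((d : ℝ) - 1) ≠ 0 := by rwa [mul_comm]
  match_scalars
  · field_simp
    ring
  · field_simp

theorem compliance_stiffness {d : ℕ} {D ν : ℝ} (hD : D ≠ 0) (hν : 1 - ν ≠ 0)
    (hd : 1 + ((d : ℝ) - 1) * ν ≠ 0) (κ : SymTens d) :
    compliance d D ν (stiffness d D ν κ) = κ := by
  simp only [stiffness, compliance, LinearMap.smul_apply, LinearMap.add_apply,
    LinearMap.sub_apply, LinearMap.smulRight_apply, LinearMap.id_apply, map_smul, map_add,
    traceTens_idTens]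
  have hd' : 1 + ν * ((d : ℝ) - 1) ≠ 0 := by rwa [mul_comm]
  match_scalars
  · field_simp
    ring
  · field_simp

/-! ### Lipschitz domains and meshes -/

/-- Around each boundary point, and in suitable Cartesian coordinates (`n` is the last coordinate
direction, `x - ⟪n, x⟫ n` represents the others), `U` is the set of points that lie strictly above
the graph of a Lipschitz function. -/
def HasLipschitzBoundary {d : ℕ} (U : Set (Pt d)) : Prop :=
  ∀ x₀ ∈ frontier U, ∃ (n : Pt d) (r : ℝ) (K : NNReal) (γ : Pt d → ℝ),
    ‖n‖ = 1 ∧ 0 < r ∧ LipschitzWith K γ ∧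
      ∀ x ∈ Metric.ball x₀ r, x ∈ U ↔ γ (x - inner ℝ n x • n) < inner ℝ n x

/-- Bounded, connected, open sets with Lipschitz boundary. -/
structure IsLipschitzDomain {d : ℕ} (U : Set (Pt d)) : Prop where
  isOpen : IsOpen U
  isConnected : IsConnected U
  isBounded : Bornology.IsBounded U
  lipschitz : HasLipschitzBoundary U

/-- A mesh of `Ω`: finitely many pairwise disjoint open Lipschitz sets contained in `Ω`, that
cover `Ω` up to a null set (for Lipschitz sets this says that their closures cover `Ω`). -/
structure Mesh {d : ℕ} (Ω : Set (Pt d)) where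
  elems : Finset (Set (Pt d))
  isOpen : ∀ T ∈ elems, IsOpen T
  lipschitz : ∀ T ∈ elems, HasLipschitzBoundary T
  subset : ∀ T ∈ elems, T ⊆ Ω
  disjoint : (elems : Set (Set (Pt d))).PairwiseDisjoint id
  covers : volume (Ω \ ⋃ T ∈ elems, T) = 0

/-! ### Weak derivatives -/

/-- `φ` is a smooth function with compact support in `U`. -/
structure IsTest {d : ℕ} (U : Set (Pt d)) (φ : Pt d → ℝ) : Prop where
  smooth : ContDiff ℝ ∞ φ
  compact : HasCompactSupport φ
  support : tsupport φ ⊆ U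

/-- The classical second partial derivative `∂ᵢ ∂ⱼ φ`. -/
def partial2 {d : ℕ} (i j : Fin d) (φ : Pt d → ℝ) (x : Pt d) : ℝ :=
  fderiv ℝ (fun y => fderiv ℝ φ y (EuclideanSpace.single j 1)) x (EuclideanSpace.single i 1)

/-- `H` is the weak Hessian `ε ∇ z` of `z` on the open set `T`. -/
def IsWeakHessianOn {d : ℕ} (T : Set (Pt d)) (z : Pt d → ℝ) (H : Pt d → SymTens d) : Prop :=
  ∀ φ, IsTest T φ → ∀ i j, ∫ x in T, z x * partial2 i j φ x = ∫ x in T, entry (H x) i j * φ x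

/-- `g` is the weak twice iterated divergence `div div Θ` of `Θ` on the open set `T`. -/
def IsWeakDivDivOn {d : ℕ} (T : Set (Pt d)) (Θ : Pt d → SymTens d) (g : Pt d → ℝ) : Prop :=
  ∀ φ, IsTest T φ →
    ∫ x in T, ∑ i, ∑ j, entry (Θ x) i j * partial2 i j φ x = ∫ x in T, g x * φ x

/-! ### The Lebesgue spaces -/

/-- `L₂(Ω)`. -/
abbrev L2 {d : ℕ} (Ω : Set (Pt d)) := Lp ℝ 2 (volume.restrict Ω)

/-- The space of symmetric tensor functions with components in `L₂(Ω)`. -/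
abbrev L2s {d : ℕ} (Ω : Set (Pt d)) := Lp (SymTens d) 2 (volume.restrict Ω)

/-- The product `X × Y` of inner product spaces with `‖(x, y)‖² = ‖x‖² + ‖y‖²`. -/
def HProd (X Y : Type*) := WithLp 2 (X × Y)

namespace HProd

variable {X Y : Type*} [NormedAddCommGroup X] [InnerProductSpace ℝ X]
  [NormedAddCommGroup Y] [InnerProductSpace ℝ Y]

instance : NormedAddCommGroup (HProd X Y) := inferInstanceAs (NormedAddCommGroup (WithLp 2 (X × Y)))

instance : InnerProductSpace ℝ (HProd X Y) :=
  inferInstanceAs (InnerProductSpace ℝ (WithLp 2 (X × Y)))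

instance [CompleteSpace X] [CompleteSpace Y] : CompleteSpace (HProd X Y) :=
  inferInstanceAs (CompleteSpace (WithLp 2 (X × Y)))

/-- The pair `(x, y)`. -/
def mk (x : X) (y : Y) : HProd X Y := WithLp.toLp 2 (x, y)

/-- The first component. -/
def fst : HProd X Y →L[ℝ] X := WithLp.fstL 2 ℝ X Y

/-- The second component. -/
def snd : HProd X Y →L[ℝ] Y := WithLp.sndL 2 ℝ X Y

@[simp] theorem fst_mk (x : X) (y : Y) : fst (mk x y) = x := rfl

@[simp] theorem snd_mk (x : X) (y : Y) : snd (mk x y) = y := rfl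

theorem norm_sq (p : HProd X Y) : ‖p‖ ^ 2 = ‖fst p‖ ^ 2 + ‖snd p‖ ^ 2 :=
  WithLp.prod_norm_sq_eq_of_L2 (α := X) (β := Y) p

end HProd

/-- Pairs `(z, H)` with `‖(z, H)‖² = ‖z‖² + ‖H‖²`. -/
abbrev PairZ {d : ℕ} (Ω : Set (Pt d)) := HProd (L2 Ω) (L2s Ω)

/-- Pairs `(Θ, g)` with `‖(Θ, g)‖² = ‖Θ‖² + ‖g‖²`. -/
abbrev PairΘ {d : ℕ} (Ω : Set (Pt d)) := HProd (L2s Ω) (L2 Ω)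

/-- The function `z` of the pair `(z, H)`. -/
abbrev fn {d : ℕ} {Ω : Set (Pt d)} : PairZ Ω →L[ℝ] L2 Ω := HProd.fst

/-- The Hessian `H` of the pair `(z, H)`. -/
abbrev hess {d : ℕ} {Ω : Set (Pt d)} : PairZ Ω →L[ℝ] L2s Ω := HProd.snd

/-- The tensor `Θ` of the pair `(Θ, g)`. -/
abbrev tens {d : ℕ} {Ω : Set (Pt d)} : PairΘ Ω →L[ℝ] L2s Ω := HProd.fst

/-- The twice iterated divergence `g` of the pair `(Θ, g)`. -/
abbrev dd {d : ℕ} {Ω : Set (Pt d)} : PairΘ Ω →L[ℝ] L2 Ω := HProd.snd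

/-! ### Linearity of weak derivatives -/

theorem IsTest.continuous_partial2 {d : ℕ} {U : Set (Pt d)} {φ : Pt d → ℝ} (h : IsTest U φ)
    (i j : Fin d) : Continuous (partial2 i j φ) := by
  have h1 : ContDiff ℝ ∞ (fun y => fderiv ℝ φ y (EuclideanSpace.single j 1)) :=
    (h.smooth.fderiv_right (m := ∞) (by simp)).clm_apply contDiff_const
  exact (h1.continuous_fderiv (by simp)).clm_apply continuous_const

theorem IsTest.hasCompactSupport_partial2 {d : ℕ} {U : Set (Pt d)} {φ : Pt d → ℝ}
    (h : IsTest U φ) (i j : Fin d) : HasCompactSupport (partial2 i j φ) :=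
  (h.compact.fderiv_apply ℝ _).fderiv_apply ℝ _

theorem integrableOn_mul {d : ℕ} {T Ω : Set (Pt d)} (hT : T ⊆ Ω) {z ψ : Pt d → ℝ}
    (hz : MemLp z 2 (volume.restrict Ω)) (hc : Continuous ψ) (hs : HasCompactSupport ψ) :
    Integrable (fun x => z x * ψ x) (volume.restrict T) :=
  MemLp.integrable_mul (p := 2) (q := 2) (hz.mono_measure (Measure.restrict_mono_set _ hT))
    (hc.memLp_of_hasCompactSupport hs)

/-- Taking an entry is continuous and linear. -/
def entryL {d : ℕ} (i j : Fin d) : SymTens d →L[ℝ] ℝ :=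
  LinearMap.toContinuousLinearMap
    { toFun := fun κ => entry κ i j
      map_add' := fun κ τ => by simp
      map_smul' := fun c κ => by simp }

theorem memLp_entry {d : ℕ} {Ω : Set (Pt d)} (Θ : L2s Ω) (i j : Fin d) :
    MemLp (fun x => entry (Θ x) i j) 2 (volume.restrict Ω) :=
  (entryL i j).comp_memLp' (Lp.memLp Θ)

theorem ae_restrict_of_subset {d : ℕ} {T Ω : Set (Pt d)} (hT : T ⊆ Ω) {P : Pt d → Prop}
    (h : ∀ᵐ x ∂(volume.restrict Ω), P x) : ∀ᵐ x ∂(volume.restrict T), P x :=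
  ae_mono (Measure.restrict_mono_set _ hT) h

theorem isWeakHessianOn_zero {d : ℕ} {T Ω : Set (Pt d)} (hT : T ⊆ Ω) :
    IsWeakHessianOn T (0 : L2 Ω) (0 : L2s Ω) := by
  intro φ hφ i j
  refine integral_congr_ae ?_
  filter_upwards [ae_restrict_of_subset hT (Lp.coeFn_zero ℝ 2 (volume.restrict Ω)),
    ae_restrict_of_subset hT (Lp.coeFn_zero (SymTens d) 2 (volume.restrict Ω))] with x h1 h2
  rw [h1, h2]
  simp

theorem IsWeakHessianOn.add {d : ℕ} {T Ω : Set (Pt d)} (hT : T ⊆ Ω) {z w : L2 Ω} {H G : L2s Ω}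
    (h1 : IsWeakHessianOn T z H) (h2 : IsWeakHessianOn T w G) :
    IsWeakHessianOn T ((z + w : L2 Ω) : Pt d → ℝ) ((H + G : L2s Ω) : Pt d → SymTens d) := by
  intro φ hφ i j
  have e1 : ∫ x in T, (z + w : L2 Ω) x * partial2 i j φ x =
      ∫ x in T, (z x * partial2 i j φ x + w x * partial2 i j φ x) := by
    refine integral_congr_ae ?_
    filter_upwards [ae_restrict_of_subset hT (Lp.coeFn_add z w)] with x hx
    rw [hx, Pi.add_apply]
    ring
  have e2 : ∫ x in T, entry ((H + G : L2s Ω) x) i j * φ x =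
      ∫ x in T, (entry (H x) i j * φ x + entry (G x) i j * φ x) := by
    refine integral_congr_ae ?_
    filter_upwards [ae_restrict_of_subset hT (Lp.coeFn_add H G)] with x hx
    rw [hx, Pi.add_apply]
    simp only [entry_add]
    ring
  rw [e1, e2, integral_add, integral_add, h1 φ hφ i j, h2 φ hφ i j]
  · exact integrableOn_mul hT (memLp_entry H i j) hφ.smooth.continuous hφ.compact
  · exact integrableOn_mul hT (memLp_entry G i j) hφ.smooth.continuous hφ.compact
  · exact integrableOn_mul hT (Lp.memLp z) (hφ.continuous_partial2 i j)
      (hφ.hasCompactSupport_partial2 i j)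
  · exact integrableOn_mul hT (Lp.memLp w) (hφ.continuous_partial2 i j)
      (hφ.hasCompactSupport_partial2 i j)

theorem IsWeakHessianOn.smul {d : ℕ} {T Ω : Set (Pt d)} (hT : T ⊆ Ω) (c : ℝ) {z : L2 Ω}
    {H : L2s Ω} (h : IsWeakHessianOn T z H) :
    IsWeakHessianOn T ((c • z : L2 Ω) : Pt d → ℝ) ((c • H : L2s Ω) : Pt d → SymTens d) := by
  intro φ hφ i j
  have e1 : ∫ x in T, (c • z : L2 Ω) x * partial2 i j φ x =
      ∫ x in T, c * (z x * partial2 i j φ x) := by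
    refine integral_congr_ae ?_
    filter_upwards [ae_restrict_of_subset hT (Lp.coeFn_smul c z)] with x hx
    rw [hx, Pi.smul_apply, smul_eq_mul]
    ring
  have e2 : ∫ x in T, entry ((c • H : L2s Ω) x) i j * φ x =
      ∫ x in T, c * (entry (H x) i j * φ x) := by
    refine integral_congr_ae ?_
    filter_upwards [ae_restrict_of_subset hT (Lp.coeFn_smul c H)] with x hx
    rw [hx, Pi.smul_apply]
    simp only [entry_smul]
    ring
  rw [e1, e2, integral_const_mul, integral_const_mul, h φ hφ i j]

theorem isWeakDivDivOn_zero {d : ℕ} {T Ω : Set (Pt d)} (hT : T ⊆ Ω) :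
    IsWeakDivDivOn T (0 : L2s Ω) (0 : L2 Ω) := by
  intro φ hφ
  refine integral_congr_ae ?_
  filter_upwards [ae_restrict_of_subset hT (Lp.coeFn_zero ℝ 2 (volume.restrict Ω)),
    ae_restrict_of_subset hT (Lp.coeFn_zero (SymTens d) 2 (volume.restrict Ω))] with x h1 h2
  rw [h1, h2]
  simp

theorem integrableOn_sum {d : ℕ} {T Ω : Set (Pt d)} (hT : T ⊆ Ω) (Θ : L2s Ω) {φ : Pt d → ℝ}
    (hφ : IsTest T φ) :
    Integrable (fun x => ∑ i, ∑ j, entry (Θ x) i j * partial2 i j φ x) (volume.restrict T) :=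
  integrable_finsetSum _ fun i _ => integrable_finsetSum _ fun j _ =>
    integrableOn_mul hT (memLp_entry Θ i j) (hφ.continuous_partial2 i j)
      (hφ.hasCompactSupport_partial2 i j)

theorem IsWeakDivDivOn.add {d : ℕ} {T Ω : Set (Pt d)} (hT : T ⊆ Ω) {Θ Ψ : L2s Ω} {f g : L2 Ω}
    (h1 : IsWeakDivDivOn T Θ f) (h2 : IsWeakDivDivOn T Ψ g) :
    IsWeakDivDivOn T ((Θ + Ψ : L2s Ω) : Pt d → SymTens d) ((f + g : L2 Ω) : Pt d → ℝ) := by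
  intro φ hφ
  have e1 : ∫ x in T, ∑ i, ∑ j, entry ((Θ + Ψ : L2s Ω) x) i j * partial2 i j φ x =
      ∫ x in T, ((∑ i, ∑ j, entry (Θ x) i j * partial2 i j φ x) +
        ∑ i, ∑ j, entry (Ψ x) i j * partial2 i j φ x) := by
    refine integral_congr_ae ?_
    filter_upwards [ae_restrict_of_subset hT (Lp.coeFn_add Θ Ψ)] with x hx
    rw [hx, Pi.add_apply]
    simp only [entry_add, add_mul, Finset.sum_add_distrib]
  have e2 : ∫ x in T, (f + g : L2 Ω) x * φ x = ∫ x in T, (f x * φ x + g x * φ x) := by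
    refine integral_congr_ae ?_
    filter_upwards [ae_restrict_of_subset hT (Lp.coeFn_add f g)] with x hx
    rw [hx, Pi.add_apply]
    ring
  rw [e1, e2, integral_add (integrableOn_sum hT Θ hφ) (integrableOn_sum hT Ψ hφ), integral_add,
    h1 φ hφ, h2 φ hφ]
  · exact integrableOn_mul hT (Lp.memLp f) hφ.smooth.continuous hφ.compact
  · exact integrableOn_mul hT (Lp.memLp g) hφ.smooth.continuous hφ.compact

theorem IsWeakDivDivOn.smul {d : ℕ} {T Ω : Set (Pt d)} (hT : T ⊆ Ω) (c : ℝ) {Θ : L2s Ω}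
    {g : L2 Ω} (h : IsWeakDivDivOn T Θ g) :
    IsWeakDivDivOn T ((c • Θ : L2s Ω) : Pt d → SymTens d) ((c • g : L2 Ω) : Pt d → ℝ) := by
  intro φ hφ
  have e1 : ∫ x in T, ∑ i, ∑ j, entry ((c • Θ : L2s Ω) x) i j * partial2 i j φ x =
      ∫ x in T, c * ∑ i, ∑ j, entry (Θ x) i j * partial2 i j φ x := by
    refine integral_congr_ae ?_
    filter_upwards [ae_restrict_of_subset hT (Lp.coeFn_smul c Θ)] with x hx
    rw [hx, Pi.smul_apply]
    simp only [entry_smul, Finset.mul_sum, mul_assoc]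
  have e2 : ∫ x in T, (c • g : L2 Ω) x * φ x = ∫ x in T, c * (g x * φ x) := by
    refine integral_congr_ae ?_
    filter_upwards [ae_restrict_of_subset hT (Lp.coeFn_smul c g)] with x hx
    rw [hx, Pi.smul_apply, smul_eq_mul]
    ring
  rw [e1, e2, integral_const_mul, integral_const_mul, h φ hφ]

/-! ### The spaces `H²(𝒯)`, `H(div div, 𝒯)`, `H²₀(Ω)`, `H(div div, Ω)`

Each space is realized as the graph of its differential operator, that is, a function is stored
together with its weak derivative, which is unique (`H2Broken_ext`, `HDivDivBroken_ext`); the norm of the graph is then the norm of the space. -/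

/-- `H²(𝒯)`: the functions `z ∈ L₂(Ω)` whose restriction to each element has its Hessian in `L₂`,
stored as `(z, ε_𝒯 ∇_𝒯 z)`, with norm `(‖z‖² + ‖ε_𝒯 ∇_𝒯 z‖²)^(1/2)`. -/
def H2Broken {d : ℕ} {Ω : Set (Pt d)} (𝒯 : Mesh Ω) : Submodule ℝ (PairZ Ω) where
  carrier := {p | ∀ T ∈ 𝒯.elems, IsWeakHessianOn T (fn p) (hess p)}
  add_mem' := fun hp hq T hT => (hp T hT).add (𝒯.subset T hT) (hq T hT)
  zero_mem' := fun T hT => isWeakHessianOn_zero (𝒯.subset T hT)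
  smul_mem' := fun c _ hp T hT => (hp T hT).smul (𝒯.subset T hT) c

/-- `H(div div, 𝒯)`: the symmetric `L₂` tensors `Θ` whose restriction to each element has
its twice iterated divergence in `L₂`, stored as `(Θ, div_𝒯 div_𝒯 Θ)`, with norm
`(‖Θ‖² + ‖div_𝒯 div_𝒯 Θ‖²)^(1/2)`. -/
def HDivDivBroken {d : ℕ} {Ω : Set (Pt d)} (𝒯 : Mesh Ω) : Submodule ℝ (PairΘ Ω) where
  carrier := {p | ∀ T ∈ 𝒯.elems, IsWeakDivDivOn T (tens p) (dd p)}
  add_mem' := fun hp hq T hT => (hp T hT).add (𝒯.subset T hT) (hq T hT)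
  zero_mem' := fun T hT => isWeakDivDivOn_zero (𝒯.subset T hT)
  smul_mem' := fun c _ hp T hT => (hp T hT).smul (𝒯.subset T hT) c

/-- `H(div div, Ω)`, stored as `(Θ, div div Θ)`. -/
def HDivDiv {d : ℕ} (Ω : Set (Pt d)) : Submodule ℝ (PairΘ Ω) where
  carrier := {p | IsWeakDivDivOn Ω (tens p) (dd p)}
  add_mem' := fun hp hq => IsWeakDivDivOn.add subset_rfl hp hq
  zero_mem' := isWeakDivDivOn_zero subset_rfl
  smul_mem' := fun c _ hp => IsWeakDivDivOn.smul subset_rfl c hp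

/-- The pairs `(φ, ε ∇ φ)` for smooth `φ` with compact support in `Ω`. -/
def testGraph {d : ℕ} (Ω : Set (Pt d)) : Set (PairZ Ω) :=
  {p | ∃ φ, IsTest Ω φ ∧ fn p =ᵐ[volume.restrict Ω] φ ∧
    ∀ i j, (fun x => entry (hess p x) i j) =ᵐ[volume.restrict Ω] partial2 i j φ}

/-- `H²₀(Ω)`, stored as `(z, ε ∇ z)`: the closure of the smooth functions with compact support in
`Ω` with respect to the norm `(‖z‖² + ‖ε ∇ z‖²)^(1/2)` (`testGraph Ω` is itself a subspace). -/
def H20 {d : ℕ} (Ω : Set (Pt d)) : Submodule ℝ (PairZ Ω) :=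
  (Submodule.span ℝ (testGraph Ω)).topologicalClosure

/-! ### Uniqueness of weak derivatives -/

theorem ae_eq_of_test {d : ℕ} {T Ω : Set (Pt d)} (hT : IsOpen T) (hTΩ : T ⊆ Ω) {f g : Pt d → ℝ}
    (hf : MemLp f 2 (volume.restrict Ω)) (hg : MemLp g 2 (volume.restrict Ω))
    (h : ∀ φ, IsTest T φ → ∫ x in T, f x * φ x = ∫ x in T, g x * φ x) :
    ∀ᵐ x ∂(volume : Measure (Pt d)), x ∈ T → f x = g x := by
  have hfg : MemLp (f - g) 2 (volume.restrict T) :=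
    (hf.sub hg).mono_measure (Measure.restrict_mono_set _ hTΩ)
  have hloc : LocallyIntegrableOn (f - g) T volume :=
    locallyIntegrableOn_of_locallyIntegrable_restrict (hfg.locallyIntegrable (by norm_num))
  have key := hT.ae_eq_zero_of_integral_contDiff_smul_eq_zero hloc fun φ h1 h2 h3 => by
    have hφ : IsTest T φ := ⟨h1, h2, h3⟩
    rw [← setIntegral_eq_integral_of_forall_compl_eq_zero (s := T)]
    · have e : ∫ x in T, φ x • (f - g) x = ∫ x in T, (f x * φ x - g x * φ x) := by
        refine integral_congr_ae (Filter.Eventually.of_forall fun x => ?_)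
        simp only [Pi.sub_apply, smul_eq_mul]
        ring
      rw [e, integral_sub (integrableOn_mul hTΩ hf h1.continuous h2)
        (integrableOn_mul hTΩ hg h1.continuous h2), h φ hφ, sub_self]
    · intro x hx
      have : φ x = 0 := image_eq_zero_of_notMem_tsupport fun hx' => hx (h3 hx')
      simp [this]
  filter_upwards [key] with x hx hxT
  exact sub_eq_zero.1 (hx hxT)

theorem ae_of_forall_elems {d : ℕ} {Ω : Set (Pt d)} (hΩ : MeasurableSet Ω) (𝒯 : Mesh Ω)
    {P : Pt d → Prop} (h : ∀ T ∈ 𝒯.elems, ∀ᵐ x ∂(volume : Measure (Pt d)), x ∈ T → P x) :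
    ∀ᵐ x ∂(volume.restrict Ω), P x := by
  rw [ae_restrict_iff' hΩ]
  have h1 : ∀ᵐ x ∂(volume : Measure (Pt d)), ∀ T ∈ 𝒯.elems, x ∈ T → P x :=
    (Finset.eventually_all 𝒯.elems).2 h
  have h2 : ∀ᵐ x ∂(volume : Measure (Pt d)), x ∉ Ω \ ⋃ T ∈ 𝒯.elems, T :=
    measure_eq_zero_iff_ae_notMem.1 𝒯.covers
  filter_upwards [h1, h2] with x hx1 hx2 hxΩ
  by_contra hP
  refine hx2 ⟨hxΩ, fun hmem => ?_⟩
  obtain ⟨T, hT, hxT⟩ := Set.mem_iUnion₂.1 hmem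
  exact hP (hx1 T hT hxT)

/-- The Hessian component of an element of `H²(𝒯)` is determined by the function component. -/
theorem H2Broken_ext {d : ℕ} {Ω : Set (Pt d)} (hΩ : IsOpen Ω) (𝒯 : Mesh Ω) {p q : PairZ Ω}
    (hp : p ∈ H2Broken 𝒯) (hq : q ∈ H2Broken 𝒯) (h : fn p = fn q) : hess p = hess q := by
  refine Lp.ext (ae_of_forall_elems hΩ.measurableSet 𝒯 fun T hT => ?_)
  have key : ∀ i j, ∀ᵐ x ∂(volume : Measure (Pt d)), x ∈ T →
      entry (hess p x) i j = entry (hess q x) i j := fun i j =>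
    ae_eq_of_test (𝒯.isOpen T hT) (𝒯.subset T hT) (memLp_entry _ i j) (memLp_entry _ i j)
      fun φ hφ => by rw [← hp T hT φ hφ i j, ← hq T hT φ hφ i j, h]
  filter_upwards [ae_all_iff.2 fun i => ae_all_iff.2 (key i)] with x hx hxT
  exact SymTens.ext fun i j => hx i j hxT

/-- The divergence component of an element of `H(div div, 𝒯)` is determined by the tensor
component. -/
theorem HDivDivBroken_ext {d : ℕ} {Ω : Set (Pt d)} (hΩ : IsOpen Ω) (𝒯 : Mesh Ω) {p q : PairΘ Ω}
    (hp : p ∈ HDivDivBroken 𝒯) (hq : q ∈ HDivDivBroken 𝒯) (h : tens p = tens q) :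
    dd p = dd q := by
  refine Lp.ext (ae_of_forall_elems hΩ.measurableSet 𝒯 fun T hT => ?_)
  exact ae_eq_of_test (𝒯.isOpen T hT) (𝒯.subset T hT) (Lp.memLp _) (Lp.memLp _)
    fun φ hφ => by rw [← hp T hT φ hφ, ← hq T hT φ hφ, h]

/-! ### Trace operators and trace spaces -/

/-- The bilinear form `(f, g)_T = ∫_T f · g`. -/
def pairOn {d : ℕ} {Ω : Set (Pt d)} (F : Type*) [NormedAddCommGroup F] [InnerProductSpace ℝ F]
    (T : Set (Pt d)) :
    Lp F 2 (volume.restrict Ω) →L[ℝ] Lp F 2 (volume.restrict Ω) →L[ℝ] ℝ :=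
  (innerSL ℝ).bilinearComp (LpToLpRestrictCLM (Pt d) F ℝ (volume.restrict Ω) 2 T)
    (LpToLpRestrictCLM (Pt d) F ℝ (volume.restrict Ω) 2 T)

theorem pairOn_apply {d : ℕ} {Ω : Set (Pt d)} {F : Type*} [NormedAddCommGroup F]
    [InnerProductSpace ℝ F] {T : Set (Pt d)} (hT : T ⊆ Ω) (f g : Lp F 2 (volume.restrict Ω)) :
    pairOn F T f g = ∫ x in T, inner ℝ (f x) (g x) := by
  have hm : (volume.restrict Ω).restrict T = volume.restrict T :=
    Measure.restrict_restrict_of_subset hT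
  have h1 := LpToLpRestrictCLM_coeFn (p := 2) ℝ T f
  have h2 := LpToLpRestrictCLM_coeFn (p := 2) ℝ T g
  simp only [pairOn, ContinuousLinearMap.bilinearComp_apply, innerSL_apply_apply]
  rw [L2.inner_def, ← hm]
  refine integral_congr_ae ?_
  filter_upwards [h1, h2] with x e1 e2
  rw [e1, e2]

/-- `⟨tr_T(Θ), z⟩_∂T = (div div Θ, z)_T - (Θ, ε ∇ z)_T`, on pairs `(Θ, div div Θ)`,
`(z, ε ∇ z)`. -/
def elementForm {d : ℕ} (Ω T : Set (Pt d)) : PairΘ Ω →L[ℝ] PairZ Ω →L[ℝ] ℝ :=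
  (pairOn ℝ T).bilinearComp dd fn -
    (pairOn (SymTens d) T).bilinearComp tens hess

theorem elementForm_apply {d : ℕ} {Ω T : Set (Pt d)} (hT : T ⊆ Ω) (q : PairΘ Ω) (p : PairZ Ω) :
    elementForm Ω T q p =
      (∫ x in T, dd q x * fn p x) - ∫ x in T, inner ℝ (tens q x) (hess p x) := by
  have h : (∫ x in T, dd q x * fn p x) =
      ∫ x in T, inner ℝ (dd q x) (fn p x) := by
    refine integral_congr_ae (Filter.Eventually.of_forall fun x => ?_)
    exact mul_comm _ _
  rw [h, ← pairOn_apply hT, ← pairOn_apply hT]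
  rfl

/-- The sum of the element contributions over the mesh. -/
def skeletonForm {d : ℕ} {Ω : Set (Pt d)} (𝒯 : Mesh Ω) : PairΘ Ω →L[ℝ] PairZ Ω →L[ℝ] ℝ :=
  ∑ T ∈ 𝒯.elems, elementForm Ω T

/-- The collective trace operator `H(div div, Ω) → H²(𝒯)'`,
`⟨tr(Θ), z⟩_𝒮 = ∑ T, ((div div Θ, z)_T - (Θ, ε ∇ z)_T)`. -/
def traceDD {d : ℕ} {Ω : Set (Pt d)} (𝒯 : Mesh Ω) :
    HDivDiv Ω →L[ℝ] StrongDual ℝ (H2Broken 𝒯) :=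
  (skeletonForm 𝒯).bilinearComp (HDivDiv Ω).subtypeL (H2Broken 𝒯).subtypeL

/-- The collective trace operator `H²₀(Ω) → H(div div, 𝒯)'`,
`⟨tr(z), Θ⟩_𝒮 = ∑ T, ((div div Θ, z)_T - (Θ, ε ∇ z)_T)`. -/
def traceGG {d : ℕ} {Ω : Set (Pt d)} (𝒯 : Mesh Ω) :
    H20 Ω →L[ℝ] StrongDual ℝ (HDivDivBroken 𝒯) :=
  (skeletonForm 𝒯).flip.bilinearComp (H20 Ω).subtypeL (HDivDivBroken 𝒯).subtypeL

/-- The trace space `H^{3/2,1/2}_{00}(𝒮)`, the range of `traceGG`. Its norm is the dual norm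
`sup ⟨v, Θ⟩_𝒮 / ‖Θ‖` over `0 ≠ Θ ∈ H(div div, 𝒯)`, that is, the operator norm. -/
abbrev TraceGG {d : ℕ} {Ω : Set (Pt d)} (𝒯 : Mesh Ω) :
    Submodule ℝ (StrongDual ℝ (HDivDivBroken 𝒯)) :=
  LinearMap.range (traceGG 𝒯 : H20 Ω →ₗ[ℝ] StrongDual ℝ (HDivDivBroken 𝒯))

/-- The trace space `H^{-3/2,-1/2}(𝒮)`, the range of `traceDD`. Its norm is the dual norm
`sup ⟨q, z⟩_𝒮 / ‖z‖` over `0 ≠ z ∈ H²(𝒯)`, that is, the operator norm. -/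
abbrev TraceDD {d : ℕ} {Ω : Set (Pt d)} (𝒯 : Mesh Ω) :
    Submodule ℝ (StrongDual ℝ (H2Broken 𝒯)) :=
  LinearMap.range (traceDD 𝒯 : HDivDiv Ω →ₗ[ℝ] StrongDual ℝ (H2Broken 𝒯))

/-! ### The ultraweak formulation -/

/-- The trial space `𝒰 = L₂(Ω) × L₂ˢ(Ω) × H^{3/2,1/2}_{00}(𝒮) × H^{-3/2,-1/2}(𝒮)`. -/
@[ext] structure Trial {d : ℕ} {Ω : Set (Pt d)} (𝒯 : Mesh Ω) where
  u : L2 Ω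
  M : L2s Ω
  uhat : TraceGG 𝒯
  qhat : TraceDD 𝒯

/-- The test space `𝒱 = H²(𝒯) × H(div div, 𝒯)`, with `‖(z, Θ)‖² = ‖z‖² + ‖Θ‖²`. -/
abbrev TestSpace {d : ℕ} {Ω : Set (Pt d)} (𝒯 : Mesh Ω) :=
  HProd (H2Broken 𝒯) (HDivDivBroken 𝒯)

/-- `𝒞⁻¹` acting pointwise on symmetric tensor functions. -/
def complianceL2 {d : ℕ} (Ω : Set (Pt d)) (D ν : ℝ) : L2s Ω →L[ℝ] L2s Ω :=
  (LinearMap.toContinuousLinearMap (compliance d D ν)).compLpL 2 (volume.restrict Ω)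

/-- The bilinear form
`b(u, M, û, q̂; z, Θ) = (M, ε_𝒯 ∇_𝒯 z + 𝒞⁻¹ Θ) + (u, div_𝒯 div_𝒯 Θ) + ⟨q̂, z⟩_𝒮 - ⟨û, Θ⟩_𝒮`. -/
def bform {d : ℕ} {Ω : Set (Pt d)} (D ν : ℝ) (𝒯 : Mesh Ω) (w : Trial 𝒯)
    (z : H2Broken 𝒯) (Θ : HDivDivBroken 𝒯) : ℝ :=
  inner ℝ w.M (hess z.1 + complianceL2 Ω D ν (tens Θ.1)) + inner ℝ w.u (dd Θ.1)
    + w.qhat.1 z - w.uhat.1 Θ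

/-- `w = (u, M, û, q̂)` solves the ultraweak formulation with right-hand side `ℓ`. -/
def IsSolution {d : ℕ} {Ω : Set (Pt d)} (D ν : ℝ) (𝒯 : Mesh Ω) (ℓ : TestSpace 𝒯 → ℝ)
    (w : Trial 𝒯) : Prop :=
  ∀ v : TestSpace 𝒯, bform D ν 𝒯 w (HProd.fst v) (HProd.snd v) = ℓ v

/-- The functional `(z, Θ) ↦ -(f, z)` of a load `f ∈ L₂(Ω)`. -/
def loadFunctional {d : ℕ} {Ω : Set (Pt d)} (𝒯 : Mesh Ω) (f : L2 Ω) : TestSpace 𝒯 → ℝ :=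
  fun v => -inner ℝ f (fn (HProd.fst v).1)

/-- `‖u‖ + ‖M‖ + ‖û‖ + ‖q̂‖`. -/
def trialNorm {d : ℕ} {Ω : Set (Pt d)} (𝒯 : Mesh Ω) (w : Trial 𝒯) : ℝ :=
  ‖w.u‖ + ‖w.M‖ + ‖w.uhat‖ + ‖w.qhat‖

end Plate

end

/-!
All the spaces are graphs of `ε ∇` or `div div` inside products of `L₂` spaces, and the form that
defines both traces is, summed over the mesh, `S(Θ, z) = (div div Θ, z) - (Θ, ε ∇ z)` over all of
`Ω` (`skeletonForm_apply`). The central fact is a duality that does not see the mesh: `div div` on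
`H(div div, Ω)` is the adjoint of `ε ∇` on `H²₀(Ω)` by definition of the weak derivative
(`mem_HDivDiv_iff`), and since `H²₀(Ω)` is closed, `ε ∇` on `H²₀(Ω)` is the adjoint of `div div` on
`H(div div, Ω)` (`mem_H20_iff`). No trace theorem and no regularity of the boundary is needed.

*Uniqueness* (`eq_zero_of_homogeneous`). For zero data, test functions in `H²₀(Ω)` and in
`H(div div, Ω)` do not see the traces. They show that `div div M = 0` on `Ω`, that `u ∈ H²₀(Ω)` and
that `ε ∇ u = -𝒞⁻¹ M`. So `(M, 𝒞⁻¹ M) = 0`, hence `M = 0`, and `u = 0` by Poincaré's inequality.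
The equation then says that both traces vanish as functionals.

*Existence and bounds* (`exists_solution`). A functional on the test space has the form
`(a, z) + (B, ε ∇ z) + (E, Θ) + (g, div div Θ)` with `a, B, E, g` bounded by its norm
(`exists_inner_representation_prod`). Lax–Milgram on `H²₀(Ω)`, which rests on Poincaré's inequality
and on the positivity of `𝒞`, gives `w` with `div div 𝒞 ε ∇ w = div div (𝒞 E - B) - a`; then
`M = 𝒞 (E - ε ∇ w)`, `u = w + g`, and the traces of `w` and of `M - B ∈ H(div div, Ω)` solve the
problem. All constants come from Poincaré's inequality and from `𝒞`, not from the mesh.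
-/

open MeasureTheory Set
open scoped ContDiff ENNReal

namespace Plate

variable {d : ℕ} {Ω : Set (Pt d)}

/-! ### Calculus of test functions -/

theorem IsTest.mono {T U : Set (Pt d)} (hTU : T ⊆ U) {φ : Pt d → ℝ} (h : IsTest T φ) :
    IsTest U φ :=
  ⟨h.smooth, h.compact, h.support.trans hTU⟩

theorem IsTest.eq_zero {U : Set (Pt d)} {φ : Pt d → ℝ} (h : IsTest U φ) {x : Pt d}
    (hx : x ∉ U) : φ x = 0 :=
  image_eq_zero_of_notMem_tsupport fun hx' => hx (h.support hx')

theorem IsTest.fderiv_apply {U : Set (Pt d)} {φ : Pt d → ℝ} (h : IsTest U φ) (v : Pt d) :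
    IsTest U (fun x => fderiv ℝ φ x v) :=
  ⟨(h.smooth.fderiv_right (m := ∞) (by simp)).clm_apply contDiff_const,
    h.compact.fderiv_apply ℝ v,
    (tsupport_fderiv_apply_subset ℝ v).trans h.support⟩

theorem IsTest.partial2 {U : Set (Pt d)} {φ : Pt d → ℝ} (h : IsTest U φ) (i j : Fin d) :
    IsTest U (partial2 i j φ) :=
  (h.fderiv_apply _).fderiv_apply _

theorem IsTest.differentiable {U : Set (Pt d)} {φ : Pt d → ℝ} (h : IsTest U φ) :
    Differentiable ℝ φ :=
  h.smooth.differentiable (by simp)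

theorem IsTest.partial2_comm {U : Set (Pt d)} {φ : Pt d → ℝ} (h : IsTest U φ) (i j : Fin d)
    (x : Pt d) : Plate.partial2 i j φ x = Plate.partial2 j i φ x := by
  have hd : Differentiable ℝ (fderiv ℝ φ) :=
    (h.smooth.fderiv_right (m := ∞) (by simp)).differentiable (by simp)
  have e : ∀ i j, Plate.partial2 i j φ x =
      fderiv ℝ (fderiv ℝ φ) x (EuclideanSpace.single i 1) (EuclideanSpace.single j 1) := by
    intro i j
    rw [Plate.partial2, fderiv_clm_apply (hd x) (differentiableAt_const _)]
    simp
  rw [e, e]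
  exact second_derivative_symmetric (fun y => (h.differentiable y).hasFDerivAt)
    (hd x).hasFDerivAt _ _

/-- Integration by parts on the whole space; the second factor need not have compact support. -/
theorem IsTest.integral_fderiv_mul {U : Set (Pt d)} {φ ψ : Pt d → ℝ} (h : IsTest U φ)
    (hψ : ContDiff ℝ ∞ ψ) (v : Pt d) :
    ∫ x, fderiv ℝ φ x v * ψ x = -∫ x, φ x * fderiv ℝ ψ x v := by
  have hψ' : Continuous fun x => fderiv ℝ ψ x v :=
    (hψ.continuous_fderiv (by simp)).clm_apply continuous_const
  rw [integral_mul_fderiv_eq_neg_fderiv_mul_of_integrable, neg_neg]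
  · exact ((h.fderiv_apply v).smooth.continuous.mul hψ.continuous).integrable_of_hasCompactSupport
      (h.fderiv_apply v).compact.mul_right
  · exact (h.smooth.continuous.mul hψ').integrable_of_hasCompactSupport h.compact.mul_right
  · exact (h.smooth.continuous.mul hψ.continuous).integrable_of_hasCompactSupport
      h.compact.mul_right
  · exact fun x _ => h.differentiable x
  · exact fun x _ => hψ.differentiable (by simp) x

theorem IsTest.integral_mul_partial2 {U V : Set (Pt d)} {φ ψ : Pt d → ℝ} (hφ : IsTest U φ)
    (hψ : IsTest V ψ) (i j : Fin d) :
    ∫ x, ψ x * Plate.partial2 i j φ x = ∫ x, Plate.partial2 i j ψ x * φ x := by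
  have h1 := (hφ.fderiv_apply (EuclideanSpace.single j 1)).integral_fderiv_mul hψ.smooth
    (EuclideanSpace.single i 1)
  have h2 := hφ.integral_fderiv_mul (hψ.fderiv_apply (EuclideanSpace.single i 1)).smooth
    (EuclideanSpace.single j 1)
  simp only [hψ.partial2_comm i j]
  simp only [Plate.partial2, mul_comm (ψ _), mul_comm _ (φ _)]
  rw [h1, h2, neg_neg]

/-- Poincaré's inequality in one direction, in the form
`∫ φ² = -2 ∫ xᵢ φ ∂ᵢφ ≤ ∫ (φ² / 2 + 2 R² (∂ᵢφ)²)`. -/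
theorem IsTest.poincare {U : Set (Pt d)} {φ : Pt d → ℝ} (h : IsTest U φ) {R : ℝ}
    (hR : ∀ x ∈ U, ‖x‖ ≤ R) (i : Fin d) :
    ∫ x, φ x ^ 2 ≤ 4 * R ^ 2 * ∫ x, fderiv ℝ φ x (EuclideanSpace.single i 1) ^ 2 := by
  set v : Pt d := EuclideanSpace.single i 1
  have hsq : IsTest U (fun x => φ x ^ 2) := by
    refine ⟨h.smooth.pow 2, ?_, ?_⟩
    · simpa only [sq] using! h.compact.mul_right (f' := φ)
    · refine Subset.trans ?_ h.support
      simp only [sq]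
      exact tsupport_mul_subset_left
  have hd := (h.fderiv_apply v)
  have hcoord : ContDiff ℝ ∞ fun x : Pt d => x i := (EuclideanSpace.proj (𝕜 := ℝ) i).contDiff
  have e1 : ∀ x, fderiv ℝ (fun x => φ x ^ 2) x v = 2 * φ x * fderiv ℝ φ x v := by
    intro x
    rw [((h.differentiable x).hasFDerivAt.pow 2).fderiv]
    simp
  have e2 : ∀ x : Pt d, fderiv ℝ (fun x : Pt d => x i) x v = 1 := by
    intro x
    have : HasFDerivAt (fun x : Pt d => x i) (EuclideanSpace.proj (𝕜 := ℝ) i) x :=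
      (EuclideanSpace.proj (𝕜 := ℝ) i).hasFDerivAt
    rw [this.fderiv]
    simp [v]
  have key := hsq.integral_fderiv_mul hcoord v
  simp only [e1, e2, mul_one] at key
  have hint1 : Integrable fun x => φ x ^ 2 :=
    hsq.smooth.continuous.integrable_of_hasCompactSupport hsq.compact
  have hint2 : Integrable fun x => fderiv ℝ φ x v ^ 2 :=
    (hd.smooth.continuous.pow 2).integrable_of_hasCompactSupport <| by
      simpa only [sq] using! hd.compact.mul_right (f' := fun x => fderiv ℝ φ x v)
  have hint3 : Integrable fun x => 2 * φ x * fderiv ℝ φ x v * x i := by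
    refine Continuous.integrable_of_hasCompactSupport ?_ ?_
    · exact ((continuous_const.mul h.smooth.continuous).mul hd.smooth.continuous).mul
        hcoord.continuous
    · exact (hd.compact.mul_left (f := fun x => 2 * φ x)).mul_right
  have hle : -∫ x, 2 * φ x * fderiv ℝ φ x v * x i ≤
      ∫ x, (1 / 2 * φ x ^ 2 + 2 * R ^ 2 * fderiv ℝ φ x v ^ 2) := by
    rw [← integral_neg]
    refine integral_mono hint3.neg ((hint1.const_mul _).add (hint2.const_mul _)) fun x => ?_
    by_cases hx : x ∈ U
    · have hxi : (x i) ^ 2 ≤ R ^ 2 := by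
        have h1 : |x i| ≤ R := (PiLp.norm_apply_le x i).trans (hR x hx)
        exact sq_le_sq' (by linarith [neg_abs_le (x i)]) ((le_abs_self _).trans h1)
      have h2 := mul_le_mul_of_nonneg_right hxi (sq_nonneg (fderiv ℝ φ x v))
      change -(2 * φ x * fderiv ℝ φ x v * x i) ≤ _
      nlinarith [sq_nonneg (φ x + 2 * (fderiv ℝ φ x v * x i))]
    · simp [h.eq_zero hx, hd.eq_zero hx]
  rw [integral_add (hint1.const_mul _) (hint2.const_mul _), integral_const_mul,
    integral_const_mul] at hle
  linarith

/-! ### Test functions as elements of the graph spaces -/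

/-- The classical Hessian of a test function, as a symmetric tensor. -/
noncomputable def IsTest.hessian {U : Set (Pt d)} {φ : Pt d → ℝ} (h : IsTest U φ) (x : Pt d) :
    SymTens d :=
  ⟨WithLp.toLp 2 fun p => Plate.partial2 p.1 p.2 φ x, fun i j => h.partial2_comm i j x⟩

theorem IsTest.entry_hessian {U : Set (Pt d)} {φ : Pt d → ℝ} (h : IsTest U φ) (x : Pt d)
    (i j : Fin d) : entry (h.hessian x) i j = Plate.partial2 i j φ x :=
  rfl

theorem IsTest.continuous_hessian {U : Set (Pt d)} {φ : Pt d → ℝ} (h : IsTest U φ) :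
    Continuous h.hessian :=
  Continuous.subtype_mk (p := fun A => A ∈ symSubmodule d)
    ((PiLp.continuous_toLp 2 _).comp (continuous_pi fun p => h.continuous_partial2 p.1 p.2)) _

theorem IsTest.hasCompactSupport_hessian {U : Set (Pt d)} {φ : Pt d → ℝ} (h : IsTest U φ) :
    HasCompactSupport h.hessian := by
  refine HasCompactSupport.intro (K := tsupport φ) h.compact fun x hx => SymTens.ext fun i j => ?_
  have hφ : IsTest (tsupport φ) φ := ⟨h.smooth, h.compact, subset_rfl⟩
  exact (hφ.partial2 i j).eq_zero hx

theorem IsTest.memLp {U : Set (Pt d)} {φ : Pt d → ℝ} (h : IsTest U φ) :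
    MemLp φ 2 (volume.restrict Ω) :=
  h.smooth.continuous.memLp_of_hasCompactSupport h.compact

theorem IsTest.memLp_hessian {U : Set (Pt d)} {φ : Pt d → ℝ} (h : IsTest U φ) :
    MemLp h.hessian 2 (volume.restrict Ω) :=
  h.continuous_hessian.memLp_of_hasCompactSupport h.hasCompactSupport_hessian

theorem IsTest.exists_mem_testGraph {φ : Pt d → ℝ} (h : IsTest Ω φ) :
    ∃ p ∈ testGraph Ω, fn p =ᵐ[volume.restrict Ω] φ ∧
      ∀ i j, (fun x => entry (hess p x) i j) =ᵐ[volume.restrict Ω] Plate.partial2 i j φ := by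
  have h1 := (h.memLp (Ω := Ω)).coeFn_toLp
  have h2 : ∀ i j, (fun x => entry (((h.memLp_hessian (Ω := Ω)).toLp _ : L2s Ω) x) i j)
      =ᵐ[volume.restrict Ω] Plate.partial2 i j φ := by
    intro i j
    filter_upwards [(h.memLp_hessian (Ω := Ω)).coeFn_toLp] with x hx
    rw [hx, h.entry_hessian]
  exact ⟨HProd.mk (h.memLp.toLp φ) (h.memLp_hessian.toLp _), ⟨φ, h, h1, h2⟩, h1, h2⟩

/-- The pairs `(φ, ε ∇ φ)` already form a subspace. -/
theorem span_testGraph_le : (Submodule.span ℝ (testGraph Ω) : Set (PairZ Ω)) ⊆ testGraph Ω := by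
  intro p hp
  induction hp using Submodule.span_induction with
  | mem p hp => exact hp
  | zero =>
    have h0 : IsTest Ω (0 : Pt d → ℝ) :=
      ⟨contDiff_const, HasCompactSupport.zero, by simp [tsupport]⟩
    refine ⟨0, h0, Lp.coeFn_zero ℝ 2 (volume.restrict Ω), fun i j => ?_⟩
    filter_upwards [Lp.coeFn_zero (SymTens d) 2 (volume.restrict Ω)] with x hx
    rw [map_zero, hx]
    simp [partial2]
  | add p q _ _ hp hq =>
    obtain ⟨φ, hφ, hp1, hp2⟩ := hp
    obtain ⟨ψ, hψ, hq1, hq2⟩ := hq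
    refine ⟨φ + ψ, ⟨hφ.smooth.add hψ.smooth, hφ.compact.add hψ.compact,
      (tsupport_add φ ψ).trans (union_subset hφ.support hψ.support)⟩, ?_, fun i j => ?_⟩
    · rw [map_add]
      filter_upwards [Lp.coeFn_add (fn p) (fn q), hp1, hq1] with x h1 h2 h3
      rw [h1, Pi.add_apply, h2, h3, Pi.add_apply]
    · rw [map_add]
      filter_upwards [Lp.coeFn_add (hess p) (hess q), hp2 i j, hq2 i j] with x h1 h2 h3
      rw [h1, Pi.add_apply, entry_add, h2, h3]
      have e : (fun y => fderiv ℝ (φ + ψ) y (EuclideanSpace.single j 1)) =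
          (fun y => fderiv ℝ φ y (EuclideanSpace.single j 1)) +
            fun y => fderiv ℝ ψ y (EuclideanSpace.single j 1) := by
        ext y
        rw [fderiv_add (hφ.differentiable y) (hψ.differentiable y)]
        rfl
      rw [partial2, partial2, partial2, e, fderiv_add ((hφ.fderiv_apply _).differentiable x)
        ((hψ.fderiv_apply _).differentiable x)]
      rfl
  | smul c p _ hp =>
    obtain ⟨φ, hφ, hp1, hp2⟩ := hp
    refine ⟨c • φ, ⟨contDiff_const.smul hφ.smooth, hφ.compact.smul_left,
      (tsupport_smul_subset_right (fun _ => c) φ).trans hφ.support⟩, ?_, fun i j => ?_⟩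
    · rw [map_smul]
      filter_upwards [Lp.coeFn_smul c (fn p), hp1] with x h1 h2
      rw [h1, Pi.smul_apply, h2, Pi.smul_apply]
    · rw [map_smul]
      filter_upwards [Lp.coeFn_smul c (hess p), hp2 i j] with x h1 h2
      rw [h1, Pi.smul_apply, entry_smul, h2]
      have e : (fun y => fderiv ℝ (c • φ) y (EuclideanSpace.single j 1)) =
          c • fun y => fderiv ℝ φ y (EuclideanSpace.single j 1) := by
        ext y
        rw [fderiv_const_smul (hφ.differentiable y)]
        rfl
      rw [partial2, partial2, e, fderiv_const_smul ((hφ.fderiv_apply _).differentiable x)]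
      rfl

/-- A closed condition on pairs `(z, H)` that holds for test functions holds on `H²₀(Ω)`. -/
theorem H20_induction {P : PairZ Ω → Prop} (hP : IsClosed {p | P p})
    (h : ∀ p ∈ testGraph Ω, P p) {p : PairZ Ω} (hp : p ∈ H20 Ω) : P p :=
  closure_minimal (fun q hq => h q (span_testGraph_le hq)) hP hp

theorem mem_H20_of_mem_testGraph {p : PairZ Ω} (hp : p ∈ testGraph Ω) : p ∈ H20 Ω :=
  Submodule.le_topologicalClosure _ (Submodule.subset_span hp)

/-! ### Poincaré's inequality on `H²₀(Ω)` -/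

theorem L2_norm_sq (f : L2 Ω) : ‖f‖ ^ 2 = ∫ x in Ω, f x ^ 2 := by
  rw [← real_inner_self_eq_norm_sq, L2.inner_def]
  simp

theorem norm_fn_le_of_mem_H20 {R : ℝ} (hR : ∀ x ∈ Ω, ‖x‖ ≤ R) (i : Fin d)
    {p : PairZ Ω} (hp : p ∈ H20 Ω) : ‖fn p‖ ≤ 4 * R ^ 2 * ‖hess p‖ := by
  refine H20_induction (P := fun p => ‖fn p‖ ≤ 4 * R ^ 2 * ‖hess p‖)
    (isClosed_le (by fun_prop) (by fun_prop)) ?_ hp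
  rintro p ⟨φ, hφ, h1, h2⟩
  set v : Pt d := EuclideanSpace.single i 1
  have a1 := hφ.poincare hR i
  have a2 := (hφ.fderiv_apply v).poincare hR i
  have e1 : ‖fn p‖ ^ 2 = ∫ x, φ x ^ 2 := by
    rw [L2_norm_sq,
      ← setIntegral_eq_integral_of_forall_compl_eq_zero (s := Ω) (f := fun x => φ x ^ 2)]
    · exact integral_congr_ae (h1.mono fun x hx => congrArg (· ^ 2) hx)
    · intro x hx
      simp [hφ.eq_zero hx]
  have e2 : ∫ x, partial2 i i φ x ^ 2 ≤ ‖hess p‖ ^ 2 := by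
    rw [← real_inner_self_eq_norm_sq, L2.inner_def,
      ← setIntegral_eq_integral_of_forall_compl_eq_zero (s := Ω)]
    · refine integral_mono_ae ?_ (L2.integrable_inner _ _) ?_
      · exact (((hφ.partial2 i i).memLp (Ω := Ω)).integrable_sq)
      · filter_upwards [h2 i i] with x hx
        rw [← hx, inner_symTens, sq]
        refine le_trans ?_ (Finset.single_le_sum (f := fun k => ∑ l, entry (hess p x) k l *
          entry (hess p x) k l) (fun k _ => Finset.sum_nonneg fun l _ => mul_self_nonneg _)
          (Finset.mem_univ i))
        exact Finset.single_le_sum (f := fun l => entry (hess p x) i l *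
          entry (hess p x) i l) (fun l _ => mul_self_nonneg _) (Finset.mem_univ i)
    · intro x hx
      simp [(hφ.partial2 i i).eq_zero hx]
  refine le_of_sq_le_sq ?_ (by positivity)
  calc ‖fn p‖ ^ 2 ≤ 4 * R ^ 2 * (4 * R ^ 2 * ∫ x, partial2 i i φ x ^ 2) := by
        rw [e1]
        exact a1.trans (mul_le_mul_of_nonneg_left a2 (by positivity))
    _ ≤ 4 * R ^ 2 * (4 * R ^ 2 * ‖hess p‖ ^ 2) := by gcongr
    _ = (4 * R ^ 2 * ‖hess p‖) ^ 2 := by ring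

/-! ### Green's formula and the duality of `H²₀(Ω)` and `H(div div, Ω)` -/

theorem mem_HDivDiv_iff_testGraph {q : PairΘ Ω} : q ∈ HDivDiv Ω ↔
    ∀ p ∈ testGraph Ω, inner ℝ (dd q) (fn p) - inner ℝ (tens q) (hess p) = 0 := by
  have key : ∀ (p : PairZ Ω) (φ : Pt d → ℝ), fn p =ᵐ[volume.restrict Ω] φ →
      (∀ i j, (fun x => entry (hess p x) i j) =ᵐ[volume.restrict Ω] partial2 i j φ) →
      (inner ℝ (dd q) (fn p) = ∫ x in Ω, dd q x * φ x) ∧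
      inner ℝ (tens q) (hess p) =
        ∫ x in Ω, ∑ i, ∑ j, entry (tens q x) i j * partial2 i j φ x := by
    intro p φ h1 h2
    constructor
    · rw [L2.inner_def]
      refine integral_congr_ae (h1.mono fun x hx => ?_)
      simp only [hx]
      exact mul_comm _ _
    · rw [L2.inner_def]
      refine integral_congr_ae ?_
      filter_upwards [ae_all_iff.2 fun i => ae_all_iff.2 (h2 i)] with x hx
      rw [inner_symTens]
      simp only [hx]
  constructor
  · rintro hq p ⟨φ, hφ, h1, h2⟩
    obtain ⟨e1, e2⟩ := key p φ h1 h2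
    rw [e1, e2, hq φ hφ, sub_self]
  · intro h φ hφ
    obtain ⟨p, hp, h1, h2⟩ := hφ.exists_mem_testGraph
    obtain ⟨e1, e2⟩ := key p φ h1 h2
    rw [← e1, ← e2, ← sub_eq_zero.1 (h p hp)]

/-- `div div` on `H(div div, Ω)` is the adjoint of the Hessian on `H²₀(Ω)`. -/
theorem mem_HDivDiv_iff {q : PairΘ Ω} : q ∈ HDivDiv Ω ↔
    ∀ p ∈ H20 Ω, inner ℝ (dd q) (fn p) - inner ℝ (tens q) (hess p) = 0 := by
  refine ⟨fun hq p hp => ?_, fun h => mem_HDivDiv_iff_testGraph.2 fun p hp =>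
    h p (mem_H20_of_mem_testGraph hp)⟩
  exact H20_induction (P := fun p => inner ℝ (dd q) (fn p) - inner ℝ (tens q) (hess p) = 0)
    (isClosed_eq (by fun_prop) (by fun_prop)) (mem_HDivDiv_iff_testGraph.1 hq) hp

/-- Conversely the Hessian on `H²₀(Ω)`, being closed, is the adjoint of `div div` on
`H(div div, Ω)`: up to the isometry `(Θ, g) ↦ (g, -Θ)` the two graphs are orthogonal complements
of each other. -/
theorem mem_H20_iff {p : PairZ Ω} : p ∈ H20 Ω ↔
    ∀ q ∈ HDivDiv Ω, inner ℝ (dd q) (fn p) - inner ℝ (tens q) (hess p) = 0 := by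
  refine ⟨fun hp q hq => mem_HDivDiv_iff.1 hq p hp, fun h => ?_⟩
  have inner_eq : ∀ x y : PairZ Ω, inner ℝ x y =
      inner ℝ (fn x) (fn y) + inner ℝ (hess x) (hess y) :=
    fun x y => WithLp.prod_inner_apply x y
  rw [H20, ← Submodule.orthogonal_orthogonal_eq_closure]
  intro x hx
  have hq : (HProd.mk (-hess x) (fn x) : PairΘ Ω) ∈ HDivDiv Ω := by
    refine mem_HDivDiv_iff_testGraph.2 fun y hy => ?_
    have := (Submodule.mem_orthogonal' _ _).1 hx y (Submodule.subset_span hy)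
    rw [inner_eq] at this
    simpa using this
  have := h _ hq
  rw [inner_eq]
  simpa using this

theorem integral_test_mul {T : Set (Pt d)} (hΩ : MeasurableSet Ω) (hT : T ⊆ Ω)
    {f ψ : Pt d → ℝ} (hψ : IsTest T ψ) :
    ∫ x in T, f x * ψ x = ∫ x in Ω, f x * ψ x :=
  (setIntegral_eq_of_subset_of_forall_sdiff_eq_zero hΩ hT fun x hx => by
    rw [hψ.eq_zero hx.2, mul_zero]).symm

/-- Integration by parts, tested with functions supported in one element. -/
theorem H20_le_H2Broken (hΩ : MeasurableSet Ω) (𝒯 : Mesh Ω) : H20 Ω ≤ H2Broken 𝒯 := by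
  intro p hp T hT φ hφ i j
  have hTΩ := 𝒯.subset T hT
  rw [integral_test_mul hΩ hTΩ (hφ.partial2 i j), integral_test_mul hΩ hTΩ hφ]
  -- Both sides are continuous in `p`, as inner products in `L₂(Ω)`.
  set F : L2 Ω := (hφ.partial2 i j).memLp.toLp _
  set G : L2 Ω := hφ.memLp.toLp φ
  have e1 : ∀ p : PairZ Ω, ∫ x in Ω, fn p x * partial2 i j φ x = inner ℝ F (fn p) := by
    intro p
    rw [L2.inner_def]
    refine integral_congr_ae ?_
    filter_upwards [((hφ.partial2 i j).memLp (Ω := Ω)).coeFn_toLp] with x hx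
    rw [hx]
    rfl
  have e2 : ∀ p : PairZ Ω, ∫ x in Ω, entry (hess p x) i j * φ x =
      inner ℝ G ((entryL i j).compLpL 2 (volume.restrict Ω) (hess p)) := by
    intro p
    rw [L2.inner_def]
    refine integral_congr_ae ?_
    filter_upwards [(hφ.memLp (Ω := Ω)).coeFn_toLp,
      (entryL i j).coeFn_compLpL (p := 2) (μ := volume.restrict Ω) (hess p)] with x hx hy
    rw [hx, hy]
    rfl
  rw [e1, e2]
  refine H20_induction (P := fun p => inner ℝ F (fn p) =
    inner ℝ G ((entryL i j).compLpL 2 (volume.restrict Ω) (hess p)))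
    (isClosed_eq (by fun_prop) (by fun_prop)) ?_ hp
  rintro p ⟨ψ, hψ, h1, h2⟩
  have hφ' := hφ.mono hTΩ
  have hfull : ∀ {f g : Pt d → ℝ}, IsTest Ω g → ∫ x in Ω, f x * g x = ∫ x, f x * g x := by
    intro f g hg
    exact setIntegral_eq_integral_of_forall_compl_eq_zero fun x hx => by
      rw [hg.eq_zero hx, mul_zero]
  have c1 : ∫ x in Ω, fn p x * partial2 i j φ x = ∫ x in Ω, ψ x * partial2 i j φ x :=
    integral_congr_ae (h1.mono fun x hx => congrArg (· * partial2 i j φ x) hx)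
  have c2 : ∫ x in Ω, entry (hess p x) i j * φ x = ∫ x in Ω, partial2 i j ψ x * φ x :=
    integral_congr_ae ((h2 i j).mono fun x hx => congrArg (· * φ x) hx)
  rw [← e1, ← e2, c1, c2, hfull (hφ'.partial2 i j), hfull hφ', hφ.integral_mul_partial2 hψ]

theorem HDivDiv_le_HDivDivBroken (hΩ : MeasurableSet Ω) (𝒯 : Mesh Ω) :
    HDivDiv Ω ≤ HDivDivBroken 𝒯 := by
  intro q hq T hT φ hφ
  have hTΩ := 𝒯.subset T hT
  rw [integral_test_mul hΩ hTΩ hφ, ← hq φ (hφ.mono hTΩ)]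
  refine (setIntegral_eq_of_subset_of_forall_sdiff_eq_zero hΩ hTΩ fun x hx => ?_).symm
  exact Finset.sum_eq_zero fun i _ => Finset.sum_eq_zero fun j _ => by
    rw [(hφ.partial2 i j).eq_zero hx.2, mul_zero]

/-- The elements are disjoint and cover `Ω` up to a null set. -/
theorem sum_pairOn {F : Type*} [NormedAddCommGroup F] [InnerProductSpace ℝ F] (𝒯 : Mesh Ω)
    (f g : Lp F 2 (volume.restrict Ω)) :
    ∑ T ∈ 𝒯.elems, pairOn F T f g = inner ℝ f g := by
  have hsub : (⋃ T ∈ 𝒯.elems, T) ⊆ Ω := iUnion₂_subset 𝒯.subset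
  have hae : (⋃ T ∈ 𝒯.elems, T) =ᵐ[volume] Ω :=
    hsub.eventuallyLE.antisymm (ae_le_set.2 𝒯.covers)
  rw [L2.inner_def, ← setIntegral_congr_set hae, integral_biUnion_finset]
  · exact Finset.sum_congr rfl fun T hT => pairOn_apply (𝒯.subset T hT) f g
  · exact fun T hT => (𝒯.isOpen T hT).measurableSet
  · exact 𝒯.disjoint
  · exact fun T hT => (L2.integrable_inner f g).mono_measure
      (Measure.restrict_mono_set _ (𝒯.subset T hT))

/-- The sum over the elements is the defect in Green's formula over `Ω`: the mesh enters only
through the broken spaces. -/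
theorem skeletonForm_apply (𝒯 : Mesh Ω) (q : PairΘ Ω) (p : PairZ Ω) :
    skeletonForm 𝒯 q p = inner ℝ (dd q) (fn p) - inner ℝ (tens q) (hess p) := by
  rw [← sum_pairOn 𝒯, ← sum_pairOn 𝒯, ← Finset.sum_sub_distrib, skeletonForm]
  simp only [_root_.sum_apply]
  rfl

/-! ### Bounds for the traces -/

theorem HProd.norm_fst_le {X Y : Type*} [NormedAddCommGroup X] [InnerProductSpace ℝ X]
    [NormedAddCommGroup Y] [InnerProductSpace ℝ Y] (p : HProd X Y) : ‖HProd.fst p‖ ≤ ‖p‖ :=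
  le_of_sq_le_sq (by rw [HProd.norm_sq p]; linarith [sq_nonneg ‖HProd.snd p‖]) (norm_nonneg _)

theorem HProd.norm_snd_le {X Y : Type*} [NormedAddCommGroup X] [InnerProductSpace ℝ X]
    [NormedAddCommGroup Y] [InnerProductSpace ℝ Y] (p : HProd X Y) : ‖HProd.snd p‖ ≤ ‖p‖ :=
  le_of_sq_le_sq (by rw [HProd.norm_sq p]; linarith [sq_nonneg ‖HProd.fst p‖]) (norm_nonneg _)

theorem abs_skeletonForm_le (𝒯 : Mesh Ω) (q : PairΘ Ω) (p : PairZ Ω) :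
    |skeletonForm 𝒯 q p| ≤ ‖dd q‖ * ‖fn p‖ + ‖tens q‖ * ‖hess p‖ := by
  rw [skeletonForm_apply]
  exact (abs_sub _ _).trans (add_le_add (abs_real_inner_le_norm _ _) (abs_real_inner_le_norm _ _))

theorem norm_traceGG_le (𝒯 : Mesh Ω) (p : H20 Ω) :
    ‖traceGG 𝒯 p‖ ≤ ‖fn p.1‖ + ‖hess p.1‖ := by
  refine ContinuousLinearMap.opNorm_le_bound _ (by positivity) fun q => ?_
  refine (abs_skeletonForm_le 𝒯 q.1 p.1).trans ?_
  have h1 : ‖dd q.1‖ ≤ ‖q‖ := HProd.norm_snd_le q.1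
  have h2 : ‖tens q.1‖ ≤ ‖q‖ := HProd.norm_fst_le q.1
  rw [mul_comm (‖fn p.1‖ + _), mul_add]
  gcongr

theorem norm_traceDD_le (𝒯 : Mesh Ω) (q : HDivDiv Ω) :
    ‖traceDD 𝒯 q‖ ≤ ‖tens q.1‖ + ‖dd q.1‖ := by
  refine ContinuousLinearMap.opNorm_le_bound _ (by positivity) fun p => ?_
  refine (abs_skeletonForm_le 𝒯 q.1 p.1).trans ?_
  have h1 : ‖fn p.1‖ ≤ ‖p‖ := HProd.norm_fst_le p.1
  have h2 : ‖hess p.1‖ ≤ ‖p‖ := HProd.norm_snd_le p.1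
  rw [add_mul, add_comm]
  gcongr

/-! ### The elasticity tensor on `L₂` -/

theorem inner_idTens {d : ℕ} (κ : SymTens d) : inner ℝ (idTens d) κ = traceTens d κ := by
  rw [inner_symTens]
  simp [entry, idTens, traceTens]

theorem inner_stiffness {d : ℕ} (D ν : ℝ) (κ : SymTens d) :
    inner ℝ (stiffness d D ν κ) κ = D * (ν * traceTens d κ ^ 2 + (1 - ν) * ‖κ‖ ^ 2) := by
  simp only [stiffness, LinearMap.smul_apply, LinearMap.add_apply, LinearMap.smulRight_apply,
    LinearMap.id_apply, inner_smul_left, inner_add_left, inner_idTens,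
    real_inner_self_eq_norm_sq, conj_trivial]
  ring

theorem traceTens_sq_le {d : ℕ} (κ : SymTens d) : traceTens d κ ^ 2 ≤ d * ‖κ‖ ^ 2 := by
  have h1 := real_inner_mul_inner_self_le (idTens d) κ
  rw [inner_idTens, inner_idTens, traceTens_idTens, real_inner_self_eq_norm_sq] at h1
  linarith

/-- The smallest eigenvalue of the elasticity tensor is `D (1 - ν)` or `D (1 + (d - 1) ν)`. -/
theorem le_inner_stiffness {d : ℕ} {D ν : ℝ} (hD : 0 ≤ D) (κ : SymTens d) :
    D * min (1 - ν) (1 + ((d : ℝ) - 1) * ν) * ‖κ‖ ^ 2 ≤ inner ℝ (stiffness d D ν κ) κ := by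
  rw [inner_stiffness, mul_assoc]
  refine mul_le_mul_of_nonneg_left ?_ hD
  rcases le_total 0 ν with h | h
  · calc _ ≤ (1 - ν) * ‖κ‖ ^ 2 := mul_le_mul_of_nonneg_right (min_le_left _ _) (sq_nonneg _)
      _ ≤ _ := le_add_of_nonneg_left (by positivity)
  · calc _ ≤ (1 + ((d : ℝ) - 1) * ν) * ‖κ‖ ^ 2 :=
          mul_le_mul_of_nonneg_right (min_le_right _ _) (sq_nonneg _)
      _ ≤ _ := by linarith [mul_le_mul_of_nonpos_left (traceTens_sq_le κ) h]

/-- `𝒞` acting pointwise on symmetric tensor functions. -/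
noncomputable def stiffnessL2 {d : ℕ} (Ω : Set (Pt d)) (D ν : ℝ) : L2s Ω →L[ℝ] L2s Ω :=
  (LinearMap.toContinuousLinearMap (stiffness d D ν)).compLpL 2 (volume.restrict Ω)

theorem stiffnessL2_coeFn (D ν : ℝ) (N : L2s Ω) :
    stiffnessL2 Ω D ν N =ᵐ[volume.restrict Ω] fun x => stiffness d D ν (N x) :=
  ContinuousLinearMap.coeFn_compLpL _ N

theorem complianceL2_coeFn (D ν : ℝ) (N : L2s Ω) :
    complianceL2 Ω D ν N =ᵐ[volume.restrict Ω] fun x => compliance d D ν (N x) :=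
  ContinuousLinearMap.coeFn_compLpL _ N

theorem inner_complianceL2_comm (D ν : ℝ) (N P : L2s Ω) :
    inner ℝ (complianceL2 Ω D ν N) P = inner ℝ N (complianceL2 Ω D ν P) := by
  rw [L2.inner_def, L2.inner_def]
  refine integral_congr_ae ?_
  filter_upwards [complianceL2_coeFn D ν N, complianceL2_coeFn D ν P] with x h1 h2
  rw [h1, h2]
  simp only [compliance, LinearMap.smul_apply, LinearMap.sub_apply, LinearMap.smulRight_apply,
    LinearMap.id_apply, inner_smul_left, inner_smul_right, inner_sub_left, inner_sub_right,
    inner_idTens, real_inner_comm (idTens d), conj_trivial]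
  ring

theorem stiffnessL2_complianceL2 {D ν : ℝ} (hD : D ≠ 0) (hν : 1 - ν ≠ 0)
    (hd : 1 + ((d : ℝ) - 1) * ν ≠ 0) (N : L2s Ω) :
    stiffnessL2 Ω D ν (complianceL2 Ω D ν N) = N := by
  refine Lp.ext ?_
  filter_upwards [stiffnessL2_coeFn D ν (complianceL2 Ω D ν N), complianceL2_coeFn D ν N]
    with x h1 h2
  rw [h1, h2, stiffness_compliance hD hν hd]

theorem complianceL2_stiffnessL2 {D ν : ℝ} (hD : D ≠ 0) (hν : 1 - ν ≠ 0)
    (hd : 1 + ((d : ℝ) - 1) * ν ≠ 0) (N : L2s Ω) :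
    complianceL2 Ω D ν (stiffnessL2 Ω D ν N) = N := by
  refine Lp.ext ?_
  filter_upwards [complianceL2_coeFn D ν (stiffnessL2 Ω D ν N), stiffnessL2_coeFn D ν N]
    with x h1 h2
  rw [h1, h2, compliance_stiffness hD hν hd]

theorem le_inner_stiffnessL2 {D ν : ℝ} (hD : 0 ≤ D) (N : L2s Ω) :
    D * min (1 - ν) (1 + ((d : ℝ) - 1) * ν) * ‖N‖ ^ 2 ≤ inner ℝ (stiffnessL2 Ω D ν N) N := by
  rw [← real_inner_self_eq_norm_sq, L2.inner_def, L2.inner_def, ← integral_const_mul]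
  refine integral_mono_ae ((L2.integrable_inner _ _).const_mul _) (L2.integrable_inner _ _) ?_
  filter_upwards [stiffnessL2_coeFn D ν N] with x hx
  rw [hx, real_inner_self_eq_norm_sq]
  exact le_inner_stiffness hD _

/-! ### The plate problem on `H²₀(Ω)` -/

/-- The Lax–Milgram theorem for the weak form of `div div (A ε ∇ w) = div div F - a` with clamped
boundary, where Poincaré's inequality with constant `κ` is assumed. -/
theorem exists_H20_solution {A : L2s Ω →L[ℝ] L2s Ω} {α κ : ℝ} (hα : 0 < α) (hκ : 0 ≤ κ)
    (hA : ∀ N, α * ‖N‖ ^ 2 ≤ inner ℝ (A N) N)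
    (hP : ∀ p ∈ H20 Ω, ‖fn p‖ ≤ κ * ‖hess p‖) (F : L2s Ω) (a : L2 Ω) :
    ∃ w ∈ H20 Ω, (∀ p ∈ H20 Ω,
      inner ℝ (A (hess w)) (hess p) = inner ℝ F (hess p) - inner ℝ a (fn p)) ∧
      ‖hess w‖ ≤ (‖F‖ + κ * ‖a‖) / α := by
  have hc : IsClosed (H20 Ω : Set (PairZ Ω)) := Submodule.isClosed_topologicalClosure _
  have : CompleteSpace (H20 Ω) := hc.completeSpace_coe
  let h : H20 Ω →L[ℝ] L2s Ω := hess.comp (H20 Ω).subtypeL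
  let B : H20 Ω →L[ℝ] H20 Ω →L[ℝ] ℝ := (innerSL ℝ).bilinearComp (A.comp h) h
  let ℓ : StrongDual ℝ (H20 Ω) :=
    (innerSL ℝ F).comp h - (innerSL ℝ a).comp (fn.comp (H20 Ω).subtypeL)
  have hB : IsCoercive B := by
    refine ⟨α / (1 + κ ^ 2), by positivity, fun w => ?_⟩
    have h1 : ‖w‖ ^ 2 = ‖fn w.1‖ ^ 2 + ‖hess w.1‖ ^ 2 := HProd.norm_sq w.1
    have h2 : ‖fn w.1‖ ^ 2 ≤ (κ * ‖hess w.1‖) ^ 2 :=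
      pow_le_pow_left₀ (norm_nonneg _) (hP w.1 w.2) 2
    refine le_trans ?_ (hA (hess w.1))
    rw [mul_assoc, ← sq, div_mul_eq_mul_div, div_le_iff₀ (by positivity), mul_assoc]
    exact mul_le_mul_of_nonneg_left (by linarith) hα.le
  let w : H20 Ω := hB.continuousLinearEquivOfBilin.symm ((InnerProductSpace.toDual ℝ _).symm ℓ)
  have hw : ∀ p : H20 Ω, B w p = ℓ p := fun p => by
    rw [← hB.continuousLinearEquivOfBilin_apply, ContinuousLinearEquiv.apply_symm_apply,
      InnerProductSpace.toDual_symm_apply]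
  have hw' : ∀ p ∈ H20 Ω,
      inner ℝ (A (hess w.1)) (hess p) = inner ℝ F (hess p) - inner ℝ a (fn p) :=
    fun p hp => hw ⟨p, hp⟩
  refine ⟨w.1, w.2, hw', ?_⟩
  rw [le_div_iff₀ hα]
  rcases (norm_nonneg (hess w.1)).eq_or_lt with h0 | h0
  · rw [← h0, zero_mul]
    positivity
  · refine le_of_mul_le_mul_right ?_ h0
    have h1 := hA (hess w.1)
    rw [hw' w.1 w.2] at h1
    have h2 := real_inner_le_norm F (hess w.1)
    have h3 := neg_le_of_abs_le (abs_real_inner_le_norm a (fn w.1))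
    have h4 := mul_le_mul_of_nonneg_left (hP w.1 w.2) (norm_nonneg a)
    nlinarith

/-! ### Representation of functionals on the test space -/

/-- By Hahn–Banach the functional extends to the whole product, so `K` need not be closed. -/
theorem exists_inner_representation {X Y : Type*} [NormedAddCommGroup X] [InnerProductSpace ℝ X]
    [NormedAddCommGroup Y] [InnerProductSpace ℝ Y] [CompleteSpace X] [CompleteSpace Y]
    (K : Submodule ℝ (HProd X Y)) (ℓ : StrongDual ℝ K) :
    ∃ (x : X) (y : Y), ‖x‖ ≤ ‖ℓ‖ ∧ ‖y‖ ≤ ‖ℓ‖ ∧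
      ∀ k : K, ℓ k = inner ℝ x (HProd.fst k.1) + inner ℝ y (HProd.snd k.1) := by
  obtain ⟨g, hg, hn⟩ := exists_extension_norm_eq K ℓ
  set r := (InnerProductSpace.toDual ℝ (HProd X Y)).symm g
  have hr : ‖r‖ = ‖ℓ‖ := by rw [← hn]; exact LinearIsometryEquiv.norm_map _ _
  refine ⟨HProd.fst r, HProd.snd r, hr ▸ HProd.norm_fst_le r, hr ▸ HProd.norm_snd_le r,
    fun k => ?_⟩
  rw [← hg k, ← InnerProductSpace.toDual_symm_apply (𝕜 := ℝ)]
  exact WithLp.prod_inner_apply r k.1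

theorem HProd.exists_add_of_dual {X Y : Type*} [NormedAddCommGroup X] [InnerProductSpace ℝ X]
    [NormedAddCommGroup Y] [InnerProductSpace ℝ Y] (ℓ : StrongDual ℝ (HProd X Y)) :
    ∃ (ℓ₁ : StrongDual ℝ X) (ℓ₂ : StrongDual ℝ Y), ‖ℓ₁‖ ≤ ‖ℓ‖ ∧ ‖ℓ₂‖ ≤ ‖ℓ‖ ∧
      ∀ v, ℓ v = ℓ₁ (HProd.fst v) + ℓ₂ (HProd.snd v) := by
  have ext : ∀ {v w : HProd X Y}, HProd.fst v = HProd.fst w → HProd.snd v = HProd.snd w →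
      v = w := fun h1 h2 => WithLp.ofLp_injective 2 (Prod.ext h1 h2)
  let i₁ : X →ₗᵢ[ℝ] HProd X Y :=
    { toFun := fun x => HProd.mk x 0
      map_add' := fun x y => ext (by simp) (by simp)
      map_smul' := fun c x => ext (by simp) (by simp)
      norm_map' := fun x => by
        refine (sq_eq_sq₀ (norm_nonneg _) (norm_nonneg _)).1 ?_
        simp [HProd.norm_sq] }
  let i₂ : Y →ₗᵢ[ℝ] HProd X Y :=
    { toFun := fun y => HProd.mk 0 y
      map_add' := fun x y => ext (by simp) (by simp)
      map_smul' := fun c x => ext (by simp) (by simp)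
      norm_map' := fun x => by
        refine (sq_eq_sq₀ (norm_nonneg _) (norm_nonneg _)).1 ?_
        simp [HProd.norm_sq] }
  refine ⟨ℓ.comp i₁.toContinuousLinearMap, ℓ.comp i₂.toContinuousLinearMap, ?_, ?_, fun v => ?_⟩
  · refine ContinuousLinearMap.opNorm_le_bound _ (norm_nonneg _) fun x => ?_
    exact (ℓ.le_opNorm _).trans_eq (congrArg (‖ℓ‖ * ·) (i₁.norm_map x))
  · refine ContinuousLinearMap.opNorm_le_bound _ (norm_nonneg _) fun x => ?_
    exact (ℓ.le_opNorm _).trans_eq (congrArg (‖ℓ‖ * ·) (i₂.norm_map x))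
  · change ℓ v = ℓ (HProd.mk _ 0) + ℓ (HProd.mk 0 _)
    rw [← map_add]
    exact congrArg ℓ (ext (by simp) (by simp))

theorem exists_inner_representation_prod {X Y Z W : Type*}
    [NormedAddCommGroup X] [InnerProductSpace ℝ X] [NormedAddCommGroup Y] [InnerProductSpace ℝ Y]
    [NormedAddCommGroup Z] [InnerProductSpace ℝ Z] [NormedAddCommGroup W] [InnerProductSpace ℝ W]
    [CompleteSpace X] [CompleteSpace Y] [CompleteSpace Z] [CompleteSpace W]
    (K : Submodule ℝ (HProd X Y)) (K' : Submodule ℝ (HProd Z W)) (ℓ : StrongDual ℝ (HProd K K')) :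
    ∃ (x : X) (y : Y) (z : Z) (w : W), ‖x‖ ≤ ‖ℓ‖ ∧ ‖y‖ ≤ ‖ℓ‖ ∧ ‖z‖ ≤ ‖ℓ‖ ∧ ‖w‖ ≤ ‖ℓ‖ ∧
      ∀ v, ℓ v = inner ℝ x (HProd.fst (HProd.fst v).1) + inner ℝ y (HProd.snd (HProd.fst v).1) +
        (inner ℝ z (HProd.fst (HProd.snd v).1) + inner ℝ w (HProd.snd (HProd.snd v).1)) := by
  obtain ⟨ℓ₁, ℓ₂, n₁, n₂, h⟩ := HProd.exists_add_of_dual ℓ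
  obtain ⟨x, y, hx, hy, h₁⟩ := exists_inner_representation K ℓ₁
  obtain ⟨z, w, hz, hw, h₂⟩ := exists_inner_representation K' ℓ₂
  refine ⟨x, y, z, w, hx.trans n₁, hy.trans n₁, hz.trans n₂, hw.trans n₂, fun v => ?_⟩
  rw [h, h₁, h₂]

/-! ### Uniqueness and existence -/

/-- Testing with `z ∈ H²₀(Ω)` and `Θ ∈ H(div div, Ω)` removes the traces. It shows that `(M, 0)`
is in `H(div div, Ω)` and that `(u, -𝒞⁻¹ M)` is in `H²₀(Ω)`, so `M` is orthogonal to `𝒞⁻¹ M`. -/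
theorem eq_zero_of_homogeneous (hΩ : MeasurableSet Ω) {D ν α κ : ℝ}
    (hα : 0 < α) (hA : ∀ N : L2s Ω, α * ‖N‖ ^ 2 ≤ inner ℝ (stiffnessL2 Ω D ν N) N)
    (hinv : ∀ N : L2s Ω, stiffnessL2 Ω D ν (complianceL2 Ω D ν N) = N)
    (hP : ∀ p ∈ H20 Ω, ‖fn p‖ ≤ κ * ‖hess p‖) (𝒯 : Mesh Ω) {M : L2s Ω} {u : L2 Ω}
    {p : H20 Ω} {q : HDivDiv Ω}
    (h : ∀ (z : H2Broken 𝒯) (Θ : HDivDivBroken 𝒯),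
      inner ℝ M (hess z.1 + complianceL2 Ω D ν (tens Θ.1)) + inner ℝ u (dd Θ.1) +
        traceDD 𝒯 q z - traceGG 𝒯 p Θ = 0) :
    M = 0 ∧ u = 0 ∧ traceDD 𝒯 q = 0 ∧ traceGG 𝒯 p = 0 := by
  have hM : (HProd.mk M 0 : PairΘ Ω) ∈ HDivDiv Ω := by
    refine mem_HDivDiv_iff.2 fun z hz => ?_
    have h1 := h ⟨z, H20_le_H2Broken hΩ 𝒯 hz⟩ 0
    have h2 : traceDD 𝒯 q ⟨z, H20_le_H2Broken hΩ 𝒯 hz⟩ = 0 :=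
      (skeletonForm_apply 𝒯 q.1 z).trans (mem_HDivDiv_iff.1 q.2 z hz)
    rw [h2] at h1
    simpa using h1
  have hu : (HProd.mk u (-complianceL2 Ω D ν M) : PairZ Ω) ∈ H20 Ω := by
    refine mem_H20_iff.2 fun Θ hΘ => ?_
    have h1 := h 0 ⟨Θ, HDivDiv_le_HDivDivBroken hΩ 𝒯 hΘ⟩
    have h2 : traceGG 𝒯 p ⟨Θ, HDivDiv_le_HDivDivBroken hΩ 𝒯 hΘ⟩ = 0 :=
      (skeletonForm_apply 𝒯 Θ p.1).trans (mem_H20_iff.1 p.2 Θ hΘ)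
    have h3 := inner_complianceL2_comm D ν (tens Θ) M
    simp only [ZeroMemClass.coe_zero, map_zero, zero_add, add_zero] at h1
    have e₁ := inner_neg_right (𝕜 := ℝ) (tens Θ) (complianceL2 Ω D ν M)
    have e₂ := real_inner_comm M (complianceL2 Ω D ν (tens Θ))
    have e₃ := real_inner_comm u (dd Θ)
    change inner ℝ (dd Θ) u - inner ℝ (tens Θ) (-complianceL2 Ω D ν M) = 0
    linarith only [h1, h2, h3, e₁, e₂, e₃]
  have h0 : inner ℝ M (complianceL2 Ω D ν M) = 0 := by
    simpa using mem_H20_iff.1 hu _ hM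
  have hN : complianceL2 Ω D ν M = 0 := by
    have h1 := hA (complianceL2 Ω D ν M)
    rw [hinv, h0] at h1
    by_contra hne
    have := norm_pos_iff.2 hne
    exact absurd h1 (not_le.2 (by positivity))
  have hM0 : M = 0 := by rw [← hinv M, hN, map_zero]
  have hu0 : u = 0 := by
    have := hP _ hu
    rw [HProd.fst_mk, HProd.snd_mk, hN, neg_zero, norm_zero, mul_zero] at this
    exact norm_le_zero_iff.1 this
  subst hM0 hu0
  refine ⟨rfl, rfl, ?_, ?_⟩
  · ext z
    simpa using h z 0
  · ext Θ
    simpa using h 0 Θ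

theorem isSolution_unique (hΩ : MeasurableSet Ω) {D ν α κ : ℝ}
    (hα : 0 < α) (hA : ∀ N : L2s Ω, α * ‖N‖ ^ 2 ≤ inner ℝ (stiffnessL2 Ω D ν N) N)
    (hinv : ∀ N : L2s Ω, stiffnessL2 Ω D ν (complianceL2 Ω D ν N) = N)
    (hP : ∀ p ∈ H20 Ω, ‖fn p‖ ≤ κ * ‖hess p‖) (𝒯 : Mesh Ω) {ℓ : TestSpace 𝒯 → ℝ}
    {w₁ w₂ : Trial 𝒯} (h₁ : IsSolution D ν 𝒯 ℓ w₁) (h₂ : IsSolution D ν 𝒯 ℓ w₂) : w₁ = w₂ := by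
  obtain ⟨u₁, M₁, ⟨_, p₁, rfl⟩, ⟨_, q₁, rfl⟩⟩ := w₁
  obtain ⟨u₂, M₂, ⟨_, p₂, rfl⟩, ⟨_, q₂, rfl⟩⟩ := w₂
  have key := eq_zero_of_homogeneous hΩ hα hA hinv hP 𝒯 (M := M₁ - M₂) (u := u₁ - u₂)
    (p := p₁ - p₂) (q := q₁ - q₂) fun z Θ => by
      have h := (h₁ (HProd.mk z Θ)).trans (h₂ (HProd.mk z Θ)).symm
      simp only [bform, HProd.fst_mk, HProd.snd_mk, ContinuousLinearMap.coe_coe] at h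
      have e₁ : traceDD 𝒯 (q₁ - q₂) z = traceDD 𝒯 q₁ z - traceDD 𝒯 q₂ z :=
        DFunLike.congr_fun ((traceDD 𝒯).map_sub q₁ q₂) z
      have e₂ : traceGG 𝒯 (p₁ - p₂) Θ = traceGG 𝒯 p₁ Θ - traceGG 𝒯 p₂ Θ :=
        DFunLike.congr_fun ((traceGG 𝒯).map_sub p₁ p₂) Θ
      have e₃ := inner_sub_left (𝕜 := ℝ) M₁ M₂ (hess z.1 + complianceL2 Ω D ν (tens Θ.1))
      have e₄ := inner_sub_left (𝕜 := ℝ) u₁ u₂ (dd Θ.1)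
      linarith only [h, e₁, e₂, e₃, e₄]
  simp only [map_sub, sub_eq_zero] at key
  obtain ⟨hM, hu, hq, hp⟩ := key
  exact Trial.ext hu hM (Subtype.ext hp) (Subtype.ext hq)

set_option maxHeartbeats 400000 in
/-- The field variables solve `𝒞⁻¹ M + ε ∇ w = E`, `div div (M - B) = a`, `u = w + g`, and the
trace variables are the traces of `(w, ε ∇ w)` and of `(M - B, a)`. -/
theorem exists_solution {D ν α κ : ℝ} (hκ : 0 ≤ κ)
    (hα : 0 < α) (hA : ∀ N : L2s Ω, α * ‖N‖ ^ 2 ≤ inner ℝ (stiffnessL2 Ω D ν N) N)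
    (hinv : ∀ N : L2s Ω, complianceL2 Ω D ν (stiffnessL2 Ω D ν N) = N)
    (hP : ∀ p ∈ H20 Ω, ‖fn p‖ ≤ κ * ‖hess p‖) (𝒯 : Mesh Ω)
    (ℓ : StrongDual ℝ (TestSpace 𝒯)) :
    ∃ w : Trial 𝒯, IsSolution D ν 𝒯 ℓ w ∧
      trialNorm 𝒯 w ≤ (3 + 2 * ‖stiffnessL2 Ω D ν‖ + (1 + 2 * κ + 2 * ‖stiffnessL2 Ω D ν‖) *
        ((‖stiffnessL2 Ω D ν‖ + 1 + κ) / α)) * ‖ℓ‖ := by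
  set A := stiffnessL2 Ω D ν
  obtain ⟨a, B, E, g, ha, hB, hE, hg, hℓ⟩ :=
    exists_inner_representation_prod (H2Broken 𝒯) (HDivDivBroken 𝒯) ℓ
  obtain ⟨w, hw, hsol, hbd⟩ := exists_H20_solution hα hκ hA hP (A E - B) a
  obtain ⟨M, hM⟩ : ∃ M : L2s Ω, M = A (E - hess w) := ⟨_, rfl⟩
  have hQ : (HProd.mk (M - B) a : PairΘ Ω) ∈ HDivDiv Ω := by
    refine mem_HDivDiv_iff.2 fun p hp => ?_
    have h1 := hsol p hp
    have e₁ := inner_sub_left (𝕜 := ℝ) (A E) B (hess p)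
    have e₂ := inner_sub_left (𝕜 := ℝ) M B (hess p)
    have e₃ := inner_sub_left (𝕜 := ℝ) (A E) (A (hess w)) (hess p)
    rw [← map_sub, ← hM] at e₃
    change inner ℝ a (fn p) - inner ℝ (M - B) (hess p) = 0
    linarith only [h1, e₁, e₂, e₃]
  have hMbd : ‖M‖ ≤ ‖A‖ * (‖ℓ‖ + ‖hess w‖) :=
    hM ▸ (A.le_opNorm _).trans (mul_le_mul_of_nonneg_left
      ((norm_sub_le _ _).trans (add_le_add_left hE _)) (norm_nonneg _))
  have hpos : 0 ≤ ‖A‖ := norm_nonneg A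
  have hwbd : ‖hess w‖ ≤ (‖A‖ + 1 + κ) / α * ‖ℓ‖ := by
    refine (hbd.trans ?_).trans_eq (div_mul_eq_mul_div _ _ _).symm
    have h1 : ‖A E - B‖ ≤ ‖A‖ * ‖ℓ‖ + ‖ℓ‖ := (norm_sub_le _ _).trans
      (add_le_add ((A.le_opNorm E).trans (mul_le_mul_of_nonneg_left hE hpos)) hB)
    have h2 := mul_le_mul_of_nonneg_left ha hκ
    gcongr
    linarith
  have hubd : ‖fn w + g‖ ≤ κ * ‖hess w‖ + ‖ℓ‖ :=
    (norm_add_le _ _).trans (add_le_add (hP w hw) hg)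
  have hpbd := norm_traceGG_le 𝒯 ⟨w, hw⟩
  have hqbd := norm_traceDD_le 𝒯 ⟨_, hQ⟩
  refine ⟨⟨fn w + g, M, ⟨traceGG 𝒯 ⟨w, hw⟩, ⟨w, hw⟩, rfl⟩,
    ⟨traceDD 𝒯 ⟨_, hQ⟩, ⟨_, hQ⟩, rfl⟩⟩, fun v => ?_, ?_⟩
  · have h1 : traceDD 𝒯 ⟨_, hQ⟩ (HProd.fst v) = inner ℝ a (fn (HProd.fst v).1) -
        inner ℝ (M - B) (hess (HProd.fst v).1) := skeletonForm_apply 𝒯 _ _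
    have h2 : traceGG 𝒯 ⟨w, hw⟩ (HProd.snd v) = inner ℝ (dd (HProd.snd v).1) (fn w) -
        inner ℝ (tens (HProd.snd v).1) (hess w) := skeletonForm_apply 𝒯 _ _
    have h3 : inner ℝ M (complianceL2 Ω D ν (tens (HProd.snd v).1)) =
        inner ℝ (E - hess w) (tens (HProd.snd v).1) := by
      refine (inner_complianceL2_comm D ν M _).symm.trans ?_
      exact congrArg (inner ℝ · (tens (HProd.snd v).1)) ((congrArg _ hM).trans (hinv (E - hess w)))
    refine Eq.trans ?_ (hℓ v).symm
    unfold bform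
    change inner ℝ M (hess (HProd.fst v).1 + complianceL2 Ω D ν (tens (HProd.snd v).1)) +
      inner ℝ (fn w + g) (dd (HProd.snd v).1) + traceDD 𝒯 ⟨_, hQ⟩ (HProd.fst v) -
      traceGG 𝒯 ⟨w, hw⟩ (HProd.snd v) = _
    have e₁ := inner_add_right (𝕜 := ℝ) M (hess (HProd.fst v).1)
      (complianceL2 Ω D ν (tens (HProd.snd v).1))
    have e₂ := inner_sub_left (𝕜 := ℝ) E (hess w) (tens (HProd.snd v).1)
    have e₃ := inner_sub_left (𝕜 := ℝ) M B (hess (HProd.fst v).1)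
    have e₄ := inner_add_left (𝕜 := ℝ) (fn w) g (dd (HProd.snd v).1)
    have e₅ := real_inner_comm (hess w) (tens (HProd.snd v).1)
    have e₆ := real_inner_comm (fn w) (dd (HProd.snd v).1)
    linarith only [h1, h2, e₁, h3, e₂, e₃, e₄, e₅, e₆]
  · simp only [HProd.fst_mk, HProd.snd_mk] at hqbd
    have h1 : ‖M - B‖ ≤ ‖M‖ + ‖B‖ := norm_sub_le _ _
    have h2 := hP w hw
    change ‖fn w + g‖ + ‖M‖ + ‖traceGG 𝒯 ⟨w, hw⟩‖ + ‖traceDD 𝒯 ⟨_, hQ⟩‖ ≤ _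
    have h3 := mul_le_mul_of_nonneg_left hwbd (show 0 ≤ 1 + 2 * κ + 2 * ‖A‖ by positivity)
    change ‖traceGG 𝒯 ⟨w, hw⟩‖ ≤ ‖fn w‖ + ‖hess w‖ at hpbd
    linarith

/-- Well-posedness with a constant that depends on `κ`, `α` and the norm of `𝒞` only. -/
theorem exists_wellPosed_const (hΩ : MeasurableSet Ω) {D ν α κ : ℝ} (hκ : 0 ≤ κ)
    (hα : 0 < α) (hA : ∀ N : L2s Ω, α * ‖N‖ ^ 2 ≤ inner ℝ (stiffnessL2 Ω D ν N) N)
    (hinv : ∀ N : L2s Ω, stiffnessL2 Ω D ν (complianceL2 Ω D ν N) = N)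
    (hinv' : ∀ N : L2s Ω, complianceL2 Ω D ν (stiffnessL2 Ω D ν N) = N)
    (hP : ∀ p ∈ H20 Ω, ‖fn p‖ ≤ κ * ‖hess p‖) :
    ∃ c : ℝ, 0 < c ∧ ∀ (𝒯 : Mesh Ω) (ℓ : StrongDual ℝ (TestSpace 𝒯)),
      (∃! w : Trial 𝒯, IsSolution D ν 𝒯 ℓ w) ∧
        ∀ w : Trial 𝒯, IsSolution D ν 𝒯 ℓ w → trialNorm 𝒯 w ≤ c * ‖ℓ‖ := by
  refine ⟨3 + 2 * ‖stiffnessL2 Ω D ν‖ + (1 + 2 * κ + 2 * ‖stiffnessL2 Ω D ν‖) *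
    ((‖stiffnessL2 Ω D ν‖ + 1 + κ) / α), by positivity, fun 𝒯 ℓ => ?_⟩
  obtain ⟨w, hw, hbd⟩ := exists_solution hκ hα hA hinv' hP 𝒯 ℓ
  have huniq := fun w' hw' => isSolution_unique hΩ hα hA hinv hP 𝒯 (w₁ := w') hw' hw
  exact ⟨⟨w, hw, huniq⟩, fun w' hw' => huniq w' hw' ▸ hbd⟩


/-! ### The constants for a bounded domain and a positive definite tensor -/

/-- The points of a bounded set have bounded norm, so its `H²₀` satisfies Poincaré's inequality. -/
theorem exists_poincare_const (hΩ : Bornology.IsBounded Ω) (i : Fin d) :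
    ∃ κ : ℝ, 0 ≤ κ ∧ ∀ p ∈ H20 Ω, ‖fn p‖ ≤ κ * ‖hess p‖ := by
  obtain ⟨R, hR⟩ := hΩ.exists_norm_le
  exact ⟨4 * R ^ 2, by positivity, fun p hp => norm_fn_le_of_mem_H20 hR i hp⟩

theorem one_add_mul_pos_of_inner_stiffness_pos {d : ℕ} (hd : 0 < d) {D ν : ℝ} (hD : 0 < D)
    (hC : ∀ κ : SymTens d, κ ≠ 0 → 0 < inner ℝ (stiffness d D ν κ) κ) :
    0 < 1 + ((d : ℝ) - 1) * ν := by
  have hd' : (0 : ℝ) < d := Nat.cast_pos.2 hd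
  have hn : ‖idTens d‖ ^ 2 = d := by
    rw [← real_inner_self_eq_norm_sq, inner_idTens, traceTens_idTens]
  have h0 : idTens d ≠ 0 := fun h => by
    rw [h, norm_zero, zero_pow two_ne_zero] at hn
    exact hd'.ne hn
  have h := hC _ h0
  rw [inner_stiffness, traceTens_idTens, hn] at h
  have h1 : D * (ν * (d : ℝ) ^ 2 + (1 - ν) * d) = D * d * (1 + ((d : ℝ) - 1) * ν) := by ring
  rw [h1] at h
  exact pos_of_mul_pos_right h (by positivity)

end Plate

theorem theorem1 {d : ℕ} (hd : d = 2 ∨ d = 3) (Ω : Set (Plate.Pt d))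
    (hΩ : Plate.IsLipschitzDomain Ω) (hΩ' : IsSimplyConnected Ω)
    (E t ν : ℝ) (hE : 0 < E) (ht : 0 < t) (hν : ν ∈ Set.Ioc (-1 : ℝ) (1 / 2))
    (hC : ∀ κ : Plate.SymTens d, κ ≠ 0 →
      0 < inner ℝ (Plate.stiffness d (Plate.rigidity E t ν) ν κ) κ) :
    ∃ c : ℝ, 0 < c ∧ ∀ 𝒯 : Plate.Mesh Ω,
      (∀ f : Plate.L2 Ω,
        (∃! w : Plate.Trial 𝒯,
          Plate.IsSolution (Plate.rigidity E t ν) ν 𝒯 (Plate.loadFunctional 𝒯 f) w) ∧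
        ∀ w : Plate.Trial 𝒯,
          Plate.IsSolution (Plate.rigidity E t ν) ν 𝒯 (Plate.loadFunctional 𝒯 f) w →
            Plate.trialNorm 𝒯 w ≤ c * ‖f‖) ∧
      (∀ L : StrongDual ℝ (Plate.TestSpace 𝒯),
        (∃! w : Plate.Trial 𝒯, Plate.IsSolution (Plate.rigidity E t ν) ν 𝒯 L w) ∧
        ∀ w : Plate.Trial 𝒯, Plate.IsSolution (Plate.rigidity E t ν) ν 𝒯 L w →
          Plate.trialNorm 𝒯 w ≤ c * ‖L‖) := by
  open Plate in
  have hd0 : 0 < d := by omega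
  obtain ⟨hν1, hν2⟩ := hν
  have hD : 0 < rigidity E t ν := by
    have : 0 < 1 - ν ^ 2 := by nlinarith
    unfold rigidity
    positivity
  have hν' : 0 < 1 - ν := by linarith
  have hdν := one_add_mul_pos_of_inner_stiffness_pos hd0 hD hC
  obtain ⟨κ, hκ, hP⟩ := exists_poincare_const hΩ.isBounded (⟨0, hd0⟩ : Fin d)
  obtain ⟨c, hc, h⟩ := exists_wellPosed_const hΩ.isOpen.measurableSet hκ
    (mul_pos hD (lt_min hν' hdν)) (fun N => le_inner_stiffnessL2 hD.le N)
    (stiffnessL2_complianceL2 hD.ne' hν'.ne' hdν.ne')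
    (complianceL2_stiffnessL2 hD.ne' hν'.ne' hdν.ne') hP
  refine ⟨c, hc, fun 𝒯 => ⟨fun f => ?_, h 𝒯⟩⟩
  -- A load is a functional on the test space of norm at most `‖f‖`.
  let ℓ : StrongDual ℝ (TestSpace 𝒯) := LinearMap.mkContinuous
    { toFun := loadFunctional 𝒯 f
      map_add' := fun v w => by
        simp only [loadFunctional, map_add, Submodule.coe_add, inner_add_right, neg_add]
      map_smul' := fun r v => by
        simp [loadFunctional, inner_smul_right] } ‖f‖ fun v => by
    refine (norm_neg _).trans_le ((norm_inner_le_norm _ _).trans ?_)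
    exact mul_le_mul_of_nonneg_left
      ((HProd.norm_fst_le (HProd.fst v).1).trans (HProd.norm_fst_le v)) (norm_nonneg f)
  have hℓ : ‖ℓ‖ ≤ ‖f‖ := LinearMap.mkContinuous_norm_le _ (norm_nonneg f) _
  obtain ⟨h1, h2⟩ := h 𝒯 ℓ
  exact ⟨h1, fun w hw => (h2 w hw).trans (mul_le_mul_of_nonneg_left hℓ hc.le)⟩
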